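/- Let $(\Omega,\mathcal F,P)$ be a probability space with a filtration $(\mathcal F_n)_{0\le n\le N}$, $N\ge 1$, and let $(X_n)_{0\le n\le N}$ be a real adapted process with $X_0=0$ and independent increments, i.e. $\Delta X_n=X_n-X_{n-1}$ is independent of $\mathcal F_{n-1}$ for $1\le n\le N$ (for the filtration generated by $X$ this says exactly that $\Delta X_1,\dots,\Delta X_N$ are independent). Let $s_0>0$, $S_n=s_0e^{X_n}$, $D=\{z\in\mathbb C: e^{zX_N}\in L^1(P)\}$, $m(z,n)=\mathbb E[e^{z\Delta X_n}]$ for $n\ge1$ and $m(z,0)=1$. Assume that no $\Delta X_n$, $1\le n\le N$, is almost surely constant and that $2\in D$. Let $\Pi$ be a complex (hence finite) Borel measure on $\mathbb C$ and $I_0=\{\operatorname{Re}z: z\in\operatorname{supp}\Pi\}$. Assume that $I_0$ is compact and $2I_0\subset D$. Let $H=f(S_N)$, where $f$ is real-valued with $f(s)=\int_{\mathbb C}s^z\,\Pi(dz)$ for $s>0$. Let $\Theta$ be the set of real predictable processes $v=(v_k)_{1\le k\le N}$ with $v_k\Delta S_k\in L^2(P)$ for all $k$, where $\Delta S_k=S_k-S_{k-1}$.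 Put $$g(z,n)=\frac{m(z+1,n)-m(1,n)m(z,n)}{m(2,n)-m(1,n)^2},\qquad h(z,n)=\prod_{i=n+1}^N\bigl(m(z,i)-g(z,i)(m(1,i)-1)\bigr),$$ $$H_n=\int_{\mathbb C} h(z,n)S_n^z\,\Pi(dz),\quad \xi_n=\int_{\mathbb C} g(z,n)h(z,n)S_{n-1}^{z-1}\,\Pi(dz),\quad \lambda_n=\frac1{S_{n-1}}\,\frac{m(1,n)-1}{m(2,n)-2m(1,n)+1}.$$ **Theorem.** Let $V_0^*=H_0$ and let $\varphi^*$ be determined by $$\varphi^*_n=\xi_n+\lambda_n\Bigl(H_{n-1}-H_0-\sum_{i=1}^{n-1}\varphi_i^*\Delta S_i\Bigr)\quad\text{a.s.},\qquad 1\le n\le N.$$ Then $V_0^*$ is real, $\varphi^*$ can be chosen in $\Theta$, and $(V_0^*,\varphi^*)$ minimizes $\mathbb E\bigl[(H-V_0-\sum_{k=1}^N v_k\Delta S_k)^2\bigr]$ over $V_0\in\mathbb R$, $v\in\Theta$. The minimal value, i.e. the variance-optimal hedging error, equals $$J_0=\int_{\mathbb C}\int_{\mathbb C}J_0(y,z)\,\Pi(dy)\,\Pi(dz),$$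 where the function $J_0(\cdot,\cdot)$ is integrable with respect to $|\Pi|\otimes|\Pi|$ and is given by $$J_0(y,z)=s_0^{y+z}\sum_{k=1}^N b(y,z;k)\,h(z,k)\,h(y,k)\prod_{\ell=2}^{k}m(y+z,\ell-1)\prod_{j=k+1}^N a(j)\quad\text{for }y,z\in\operatorname{supp}\Pi,$$ and $J_0(y,z)=0$ otherwise, with $$a(j)=\frac{m(2,j)-m(1,j)^2}{m(2,j)-2m(1,j)+1},\qquad b(y,z;k)=\frac{\rho(y,z;k)\rho(1,1;k)-\rho(y,1;k)\rho(z,1;k)}{\rho(1,1;k)},$$ $$\rho(y,z;k)=m(y+z,k)-m(y,k)m(z,k).$$ Empty products equal $1$. -/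

import Mathlib

open MeasureTheory ProbabilityTheory

namespace DiscreteHedging

noncomputable section

/-- The increment `ΔY_n = Y_n - Y_{n-1}` (used for `n ≥ 1`). -/
def incr {Ω : Type*} (Y : ℕ → Ω → ℝ) (n : ℕ) (ω : Ω) : ℝ := Y n ω - Y (n - 1) ω

/-! ### The discrete time optimization problem -/

/-- The set `Θ` of real predictable processes `v` on `{1, …, N}` such that `v_k ΔS_k ∈ L²(P)` for
`k = 1, …, N`. -/
def Theta {Ω : Type*} {mΩ : MeasurableSpace Ω} (P : Measure Ω) (ℱ : Filtration ℕ mΩ)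
    (S : ℕ → Ω → ℝ) (N : ℕ) : Set (ℕ → Ω → ℝ) :=
  {v | ∀ k ∈ Finset.Icc 1 N, Measurable[ℱ (k - 1)] (v k) ∧
    MemLp (fun ω => v k ω * incr S k ω) 2 P}

/-- The gain `G_k(v) = ∑_{j=1}^k v_j ΔS_j`. -/
def gain {Ω : Type*} (S v : ℕ → Ω → ℝ) (k : ℕ) (ω : Ω) : ℝ :=
  ∑ j ∈ Finset.Icc 1 k, v j ω * incr S j ω

/-- The mean squared hedging error `𝔼[(H - V₀ - G_N(v))²]`. -/
def hedgingError {Ω : Type*} {mΩ : MeasurableSpace Ω} (P : Measure Ω) (S : ℕ → Ω → ℝ) (N : ℕ)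
    (H : Ω → ℝ) (V₀ : ℝ) (v : ℕ → Ω → ℝ) : ℝ :=
  ∫ ω, (H ω - V₀ - gain S v N ω) ^ 2 ∂P

/-! ### Exponentials of processes with independent increments -/

/-- `S_n = s₀ exp(X_n)`. -/
def price {Ω : Type*} (s₀ : ℝ) (X : ℕ → Ω → ℝ) (n : ℕ) (ω : Ω) : ℝ := s₀ * Real.exp (X n ω)

/-- The set `D` of all complex `z` such that `exp(z X_N) ∈ L¹(P)`. -/
def expDomain {Ω : Type*} {mΩ : MeasurableSpace Ω} (P : Measure Ω) (X : ℕ → Ω → ℝ) (N : ℕ) :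
    Set ℂ :=
  {z | Integrable (fun ω => Complex.exp (z * (X N ω : ℂ))) P}

/-- The discrete cumulant generating function: `m(z,n) = 𝔼[exp(z ΔX_n)]` for `n ≥ 1` and
`m(z,0) = 1`. -/
def m {Ω : Type*} {mΩ : MeasurableSpace Ω} (P : Measure Ω) (X : ℕ → Ω → ℝ) (z : ℂ) (n : ℕ) : ℂ :=
  if n = 0 then 1 else complexMGF (incr X n) P z

/-- `g(z,n) = (m(z+1,n) - m(1,n) m(z,n)) / (m(2,n) - m(1,n)²)`. -/
def g {Ω : Type*} {mΩ : MeasurableSpace Ω} (P : Measure Ω) (X : ℕ → Ω → ℝ) (z : ℂ) (n : ℕ) : ℂ :=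
  (m P X (z + 1) n - m P X 1 n * m P X z n) / (m P X 2 n - m P X 1 n ^ 2)

/-- `h(z,n) = ∏_{i=n+1}^N (m(z,i) - g(z,i) (m(1,i) - 1))`. -/
def h {Ω : Type*} {mΩ : MeasurableSpace Ω} (P : Measure Ω) (X : ℕ → Ω → ℝ) (N : ℕ) (z : ℂ)
    (n : ℕ) : ℂ :=
  ∏ i ∈ Finset.Icc (n + 1) N, (m P X z i - g P X z i * (m P X 1 i - 1))

/-- `ρ(y,z;k) = m(y+z,k) - m(y,k) m(z,k)`. -/
def rho {Ω : Type*} {mΩ : MeasurableSpace Ω} (P : Measure Ω) (X : ℕ → Ω → ℝ) (y z : ℂ) (k : ℕ) :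
    ℂ :=
  m P X (y + z) k - m P X y k * m P X z k

/-- `b(y,z;k) = (ρ(y,z;k) ρ(1,1;k) - ρ(y,1;k) ρ(z,1;k)) / ρ(1,1;k)`. -/
def b {Ω : Type*} {mΩ : MeasurableSpace Ω} (P : Measure Ω) (X : ℕ → Ω → ℝ) (y z : ℂ) (k : ℕ) :
    ℂ :=
  (rho P X y z k * rho P X 1 1 k - rho P X y 1 k * rho P X z 1 k) / rho P X 1 1 k

/-- `a(j) = (m(2,j) - m(1,j)²) / (m(2,j) - 2 m(1,j) + 1)`. -/
def a {Ω : Type*} {mΩ : MeasurableSpace Ω} (P : Measure Ω) (X : ℕ → Ω → ℝ) (j : ℕ) : ℂ :=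
  (m P X 2 j - m P X 1 j ^ 2) / (m P X 2 j - 2 * m P X 1 j + 1)

/-! ### Claims given by a complex measure -/

/-- The support of a complex measure: the support of its total variation. -/
def supp (Pi : ComplexMeasure ℂ) : Set ℂ := Pi.variation.support

/-- The integral `∫ F(z) Π(dz)` of a complex function against a complex measure. -/
def cint (Pi : ComplexMeasure ℂ) (F : ℂ → ℂ) : ℂ := Pi.integral F (ContinuousLinearMap.mul ℝ ℂ)

/-- `H_n = ∫ h(z,n) S_n^z Π(dz)`. -/
def claim {Ω : Type*} {mΩ : MeasurableSpace Ω} (P : Measure Ω) (X : ℕ → Ω → ℝ) (N : ℕ) (s₀ : ℝ)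
    (Pi : ComplexMeasure ℂ) (n : ℕ) (ω : Ω) : ℂ :=
  cint Pi fun z => h P X N z n * (price s₀ X n ω : ℂ) ^ z

/-- `ξ_n = ∫ g(z,n) h(z,n) S_{n-1}^{z-1} Π(dz)`. -/
def xi {Ω : Type*} {mΩ : MeasurableSpace Ω} (P : Measure Ω) (X : ℕ → Ω → ℝ) (N : ℕ) (s₀ : ℝ)
    (Pi : ComplexMeasure ℂ) (n : ℕ) (ω : Ω) : ℂ :=
  cint Pi fun z => g P X z n * h P X N z n * (price s₀ X (n - 1) ω : ℂ) ^ (z - 1)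

/-- `λ_n = (1 / S_{n-1}) (m(1,n) - 1) / (m(2,n) - 2 m(1,n) + 1)`. -/
def lam {Ω : Type*} {mΩ : MeasurableSpace Ω} (P : Measure Ω) (X : ℕ → Ω → ℝ) (s₀ : ℝ) (n : ℕ)
    (ω : Ω) : ℂ :=
  1 / (price s₀ X (n - 1) ω : ℂ) * ((m P X 1 n - 1) / (m P X 2 n - 2 * m P X 1 n + 1))

open Classical in
/-- `J₀(y,z) = s₀^{y+z} ∑_{k=1}^N b(y,z;k) h(z,k) h(y,k) ∏_{ℓ=2}^k m(y+z,ℓ-1) ∏_{j=k+1}^N a(j)` if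
`y, z ∈ supp Π`, and `0` otherwise. -/
def J₀ {Ω : Type*} {mΩ : MeasurableSpace Ω} (P : Measure Ω) (X : ℕ → Ω → ℝ) (N : ℕ) (s₀ : ℝ)
    (Pi : ComplexMeasure ℂ) (y z : ℂ) : ℂ :=
  if y ∈ supp Pi ∧ z ∈ supp Pi then
    (s₀ : ℂ) ^ (y + z) * ∑ k ∈ Finset.Icc 1 N, b P X y z k * h P X N z k * h P X N y k *
      (∏ l ∈ Finset.Icc 2 k, m P X (y + z) (l - 1)) * ∏ j ∈ Finset.Icc (k + 1) N, a P X j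
  else 0

end

end DiscreteHedging

/-! Write Π = u·|Π| with |u| = 1. Then H_n is a function η_n of log S_n, and ξ_n S_{n-1} is a
function χ_n of log S_{n-1}, both Laplace-type integrals over a vertical strip containing the
support of Π. The coefficient g(z,n) is the regression coefficient of exp(zΔX_n) on exp(ΔX_n), and h
is the resulting backward product. So for each frozen value of log S_n the change of H over a period
equals χ times the return plus a residual orthogonal to 1 and to the return (`integral_resid`,
`integral_resid_mul_ret`). As the increment is independent of the past, the residual is orthogonal
to everything that the past and the return times the past can produce (`integral_mul_resid`); this
is the Föllmer–Schweizer decomposition.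

For an arbitrary (V, v) let D_n be H_n minus the wealth. One step reads D' = D + W R + L, with D, W
known at time n, R the return, independent of the past, and L the residual. With A = E R and B = E
R², completing the square in W (`integral_sq_one_period`) gives E D'² = E L² + (1 - A²/B) E D² + B
E(W + (A/B) D)². Dropping the last term yields a recursive lower bound for the error. Equality holds
if D_0 = 0 and W = -(A/B) D in every period, which are exactly the choice V = H_0 and the feedback
formula for φ*; moreover 1 - A²/B = a(n+1).

The bound unrolls to a sum of E L² weighted by products of a(j). By Fubini E L² is a double integral
against Π ⊗ Π, and independence splits its kernel into E S_n^{y+z} and the covariance of two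
regression residuals, which is b(y,z;n+1) (`integral_residKernel_mul`). All interchanges rest on the
envelope exp(αx) + exp(βx), where α, β are the extreme points of I_0: it is square integrable at X_N
because 2α, 2β lie in D, and independence passes this on to every X_n and every increment. -/

namespace DiscreteHedging

/-! ### Polar decomposition of a complex measure -/

section Density

variable {E : Type*} {mE : MeasurableSpace E}

/-- The variation is dominated by the sum of the total variations of the real and imaginary parts,
and signed measures have finite total variation. -/
theorem isFiniteMeasure_variation (c : ComplexMeasure E) : IsFiniteMeasure c.variation := by
  have hle : c.variation ≤ (ComplexMeasure.re c).totalVariation +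
      (ComplexMeasure.im c).totalVariation := by
    refine VectorMeasure.variation_le_of_forall_enorm_le fun s hs => ?_
    have h1 := SignedMeasure.enorm_le_totalVariation (ComplexMeasure.re c) s
    have h2 := SignedMeasure.enorm_le_totalVariation (ComplexMeasure.im c) s
    have h3 : c s = ((ComplexMeasure.re c s : ℝ) : ℂ) + (ComplexMeasure.im c s : ℝ) * Complex.I :=
      (Complex.re_add_im (c s)).symm
    calc ‖c s‖ₑ ≤ ‖((ComplexMeasure.re c s : ℝ) : ℂ)‖ₑ +
          ‖((ComplexMeasure.im c s : ℝ) : ℂ) * Complex.I‖ₑ := by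
            rw [h3]; exact enorm_add_le _ _
      _ ≤ _ := by
        rw [Measure.add_apply]
        refine add_le_add (le_trans (le_of_eq ?_) h1) (le_trans (le_of_eq ?_) h2)
        · simp [enorm_eq_nnnorm]
        · simp [enorm_eq_nnnorm]
  exact isFiniteMeasure_of_le _ hle

/-- Real and imaginary parts are absolutely continuous with respect to the variation, so the
Radon–Nikodym theorem for signed measures applies to each of them. -/
theorem exists_withDensityᵥ_variation (c : ComplexMeasure E) :
    ∃ u : E → ℂ, Measurable u ∧ Integrable u c.variation ∧ c.variation.withDensityᵥ u = c := by
  have := isFiniteMeasure_variation c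
  have hre : ComplexMeasure.re c ≪ᵥ c.variation.toENNRealVectorMeasure := by
    refine VectorMeasure.AbsolutelyContinuous.mk fun i hi h0 => ?_
    rw [Measure.toENNRealVectorMeasure_apply_measurable hi] at h0
    have := c.enorm_measure_le_variation i
    rw [h0] at this
    have h0 : c i = 0 := by simpa using this
    change (c i).re = 0
    simp [h0]
  have him : ComplexMeasure.im c ≪ᵥ c.variation.toENNRealVectorMeasure := by
    refine VectorMeasure.AbsolutelyContinuous.mk fun i hi h0 => ?_
    rw [Measure.toENNRealVectorMeasure_apply_measurable hi] at h0
    have := c.enorm_measure_le_variation i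
    rw [h0] at this
    have h0 : c i = 0 := by simpa using this
    change (c i).im = 0
    simp [h0]
  set r := (ComplexMeasure.re c).rnDeriv c.variation
  set q := (ComplexMeasure.im c).rnDeriv c.variation
  have hr : Integrable r c.variation := SignedMeasure.integrable_rnDeriv _ _
  have hq : Integrable q c.variation := SignedMeasure.integrable_rnDeriv _ _
  have hrm : Measurable r := SignedMeasure.measurable_rnDeriv _ _
  have hqm : Measurable q := SignedMeasure.measurable_rnDeriv _ _
  have hu : Integrable (fun x => (r x : ℂ) + (q x : ℂ) * Complex.I) c.variation :=
    hr.ofReal.add (hq.ofReal.mul_const _)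
  refine ⟨fun x => (r x : ℂ) + (q x : ℂ) * Complex.I, by fun_prop, hu, ?_⟩
  ext s hs
  rw [withDensityᵥ_apply hu hs, integral_add hr.ofReal.restrict
    (hq.ofReal.mul_const _).restrict, integral_mul_const,
    integral_complex_ofReal, integral_complex_ofReal,
    ← withDensityᵥ_apply hr hs, ← withDensityᵥ_apply hq hs,
    SignedMeasure.withDensityᵥ_rnDeriv_eq _ _ hre, SignedMeasure.withDensityᵥ_rnDeriv_eq _ _ him]
  exact Complex.re_add_im (c s)

/-- Polar decomposition of a complex measure with respect to its total variation. -/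
theorem exists_polar_density (c : ComplexMeasure E) :
    ∃ u : E → ℂ, Measurable u ∧ (∀ x, ‖u x‖ = 1) ∧
      ∀ s, MeasurableSet s → c s = ∫ x in s, u x ∂c.variation := by
  have := isFiniteMeasure_variation c
  obtain ⟨u, hum, hui, hu⟩ := exists_withDensityᵥ_variation c
  have hvar := Measure.variation_withDensityᵥ hui
  rw [hu] at hvar
  -- The variation of u·|c| is ‖u‖·|c|, and it is also |c|; uniqueness of densities forces ‖u‖ = 1
  -- almost everywhere. Below, u is reset to 1 on the exceptional null set to get norm one
  -- everywhere.
  have hone : (fun x => ‖u x‖ₑ) =ᵐ[c.variation] fun _ => 1 := by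
    refine (withDensity_eq_iff_of_sigmaFinite (by fun_prop) aemeasurable_const).1 ?_
    rw [← hvar]
    exact withDensity_one.symm
  classical
  have hs : MeasurableSet {x | ‖u x‖ = 1} := measurableSet_eq_fun (by fun_prop) (by fun_prop)
  refine ⟨fun x => if ‖u x‖ = 1 then u x else 1, Measurable.ite hs hum measurable_const,
    fun x => ?_, fun s hs => ?_⟩
  · dsimp only
    split_ifs with h <;> simp [h]
  · have h1 : c s = ∫ x in s, u x ∂c.variation := by
      rw [← withDensityᵥ_apply hui hs, hu]
    rw [h1]
    refine (integral_congr_ae (ae_restrict_of_ae ?_)).symm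
    filter_upwards [hone] with x hx
    have : ‖u x‖ = 1 := by
      have := congrArg ENNReal.toReal hx
      simpa using this
    simp [this]

end Density

/-- Reduces integration against κ to a Bochner integral. No integrability of F is needed: since ‖u‖
= 1, F and F·u are integrable together, and otherwise both sides take the default value 0. -/
theorem exists_cint_eq_integral (κ : ComplexMeasure ℂ) :
    ∃ u : ℂ → ℂ, Measurable u ∧ (∀ z, ‖u z‖ = 1) ∧
      ∀ F : ℂ → ℂ, cint κ F = ∫ z, F z * u z ∂κ.variation := by
  have := isFiniteMeasure_variation κ
  obtain ⟨u, hum, hu1, hu⟩ := exists_polar_density κ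
  have hmul : ∀ F : ℂ → ℂ, Integrable F κ.variation →
      Integrable (fun z => F z * u z) κ.variation := fun F hF =>
    hF.mul_bdd (c := 1) hum.aestronglyMeasurable (ae_of_all _ fun z => (hu1 z).le)
  refine ⟨u, hum, hu1, fun F => ?_⟩
  by_cases hF : Integrable F κ.variation
  · refine Integrable.induction (μ := κ.variation)
      (fun F => cint κ F = ∫ z, F z * u z ∂κ.variation) ?_ ?_ ?_ ?_ hF
    · intro c s hs hfin
      have h1 : cint κ (s.indicator fun _ => c) = c * κ s :=
        setToFun_indicator_const
          (dominatedFinMeasAdditive_cbmApplyMeasure κ _) hs hfin.ne c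
      rw [h1, hu s hs, ← integral_const_mul, ← integral_indicator hs]
      refine integral_congr_ae (ae_of_all _ fun z => ?_)
      by_cases hz : z ∈ s <;> simp [hz]
    · intro f g _ hf hg ihf ihg
      have h1 : cint κ (f + g) = cint κ f + cint κ g := VectorMeasure.integral_add hf hg
      rw [h1, ihf, ihg, ← integral_add (hmul f hf) (hmul g hg)]
      simp only [Pi.add_apply, add_mul]
    · refine isClosed_eq VectorMeasure.continuous_integral ?_
      refine LipschitzWith.continuous (K := 1) (LipschitzWith.of_dist_le_mul fun f g => ?_)
      have hf := L1.integrable_coeFn f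
      have hg := L1.integrable_coeFn g
      rw [dist_eq_norm, ← integral_sub (hmul f hf) (hmul g hg), dist_eq_norm,
        L1.norm_eq_integral_norm, NNReal.coe_one, one_mul]
      refine (norm_integral_le_integral_norm _).trans (le_of_eq (integral_congr_ae ?_))
      filter_upwards [Lp.coeFn_sub f g] with z hz
      rw [hz, ← sub_mul, norm_mul, hu1, mul_one, Pi.sub_apply]
    · intro f g hfg _ hf
      have h1 : cint κ g = cint κ f := (VectorMeasure.integral_congr_ae hfg).symm
      rw [h1, hf]
      refine integral_congr_ae ?_
      filter_upwards [hfg] with z hz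
      rw [hz]
  · rw [cint, VectorMeasure.integral_undef hF, integral_undef]
    -- Multiplying F·u by the conjugate of u recovers F, so integrability of F·u would give that of
    -- F.
    intro h
    refine hF ((h.mul_bdd (c := 1) (f := fun z => F z * u z) (g := fun z => star (u z)) (by fun_prop)
      (ae_of_all _ fun z => by simp [hu1 z])).congr (ae_of_all _ fun z => ?_))
    have : u z * star (u z) = 1 := by
      simp [Complex.mul_conj, Complex.normSq_eq_norm_sq, hu1 z]
    simp only [mul_assoc, this, mul_one]

/-! ### Exponential integrals over a vertical strip -/

/-- The closed vertical strip `α ≤ Re z ≤ β`. -/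
def strip (α β : ℝ) : Set ℂ := {z | α ≤ z.re ∧ z.re ≤ β}

/-- The envelope `exp (α x) + exp (β x)` of `|exp (z x)|` on the strip. -/
noncomputable def expEnv (α β x : ℝ) : ℝ := Real.exp (α * x) + Real.exp (β * x)

theorem expEnv_pos (α β x : ℝ) : 0 < expEnv α β x := by unfold expEnv; positivity

@[fun_prop]
theorem measurable_expEnv (α β : ℝ) : Measurable (expEnv α β) := by unfold expEnv; fun_prop

/-- The product contains both terms of the left side plus positive cross terms. This separates the
past from the next increment in every estimate. -/
theorem expEnv_add_le (α β x y : ℝ) :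
    expEnv α β (x + y) ≤ expEnv α β x * expEnv α β y := by
  simp only [expEnv, mul_add, Real.exp_add]
  nlinarith [mul_pos (Real.exp_pos (α * x)) (Real.exp_pos (β * y)),
    mul_pos (Real.exp_pos (β * x)) (Real.exp_pos (α * y))]

theorem norm_cexp_mul_le_expEnv {α β : ℝ} {z : ℂ} (hz : z ∈ strip α β) (x : ℝ) :
    ‖Complex.exp (z * x)‖ ≤ expEnv α β x := by
  rw [Complex.norm_exp, Complex.re_mul_ofReal, expEnv]
  rcases le_total 0 x with hx | hx
  · have := Real.exp_le_exp.2 (mul_le_mul_of_nonneg_right hz.2 hx)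
    linarith [Real.exp_pos (α * x)]
  · have := Real.exp_le_exp.2 (mul_le_mul_of_nonpos_right hz.1 hx)
    linarith [Real.exp_pos (β * x)]

/-- Measurable functions on `ℂ` that are bounded on `K`. -/
structure BddOn (K : Set ℂ) (c : ℂ → ℂ) : Prop where
  measurable : Measurable c
  bdd : ∃ C, 0 ≤ C ∧ ∀ z ∈ K, ‖c z‖ ≤ C

namespace BddOn

variable {K : Set ℂ} {c d : ℂ → ℂ}

theorem const (a : ℂ) : BddOn K fun _ => a :=
  ⟨measurable_const, ‖a‖, norm_nonneg _, fun _ _ => le_rfl⟩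

theorem mul (hc : BddOn K c) (hd : BddOn K d) : BddOn K fun z => c z * d z := by
  obtain ⟨hcm, C, hC, hcb⟩ := hc
  obtain ⟨hdm, D, hD, hdb⟩ := hd
  refine ⟨hcm.mul hdm, C * D, mul_nonneg hC hD, fun z hz => ?_⟩
  rw [norm_mul]
  exact mul_le_mul (hcb z hz) (hdb z hz) (norm_nonneg _) hC

theorem sub (hc : BddOn K c) (hd : BddOn K d) : BddOn K fun z => c z - d z := by
  obtain ⟨hcm, C, hC, hcb⟩ := hc
  obtain ⟨hdm, D, hD, hdb⟩ := hd
  exact ⟨hcm.sub hdm, C + D, add_nonneg hC hD, fun z hz =>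
    (norm_sub_le _ _).trans (add_le_add (hcb z hz) (hdb z hz))⟩

theorem prod {ι : Type*} (s : Finset ι) {c : ι → ℂ → ℂ} (hc : ∀ i ∈ s, BddOn K (c i)) :
    BddOn K fun z => ∏ i ∈ s, c i z := by
  classical
  induction s using Finset.induction_on with
  | empty => simpa using const 1
  | insert i s his ih =>
    simp only [Finset.prod_insert his]
    exact (hc i (by simp)).mul (ih fun j hj => hc j (by simp [hj]))

end BddOn

/-- The exponential integral `∫ c(z) exp(z x) μ(dz)`. -/
noncomputable def lap (μ : Measure ℂ) (c : ℂ → ℂ) (x : ℝ) : ℂ :=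
  ∫ z, c z * Complex.exp (z * x) ∂μ

section Lap

variable {μ : Measure ℂ} [IsFiniteMeasure μ] {α β : ℝ} {c d : ℂ → ℂ}

theorem integrable_lap (hμ : ∀ᵐ z ∂μ, z ∈ strip α β) (hc : BddOn (strip α β) c) (x : ℝ) :
    Integrable (fun z => c z * Complex.exp (z * x)) μ := by
  obtain ⟨hcm, C, hC, hcb⟩ := hc
  refine Integrable.of_bound (by fun_prop) (C * expEnv α β x) ?_
  filter_upwards [hμ] with z hz
  rw [norm_mul]
  exact mul_le_mul (hcb z hz) (norm_cexp_mul_le_expEnv hz x) (norm_nonneg _) hC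

theorem norm_lap_le (hμ : ∀ᵐ z ∂μ, z ∈ strip α β) (hc : BddOn (strip α β) c) :
    ∃ C, 0 ≤ C ∧ ∀ x, ‖lap μ c x‖ ≤ C * expEnv α β x := by
  obtain ⟨hcm, C, hC, hcb⟩ := hc
  refine ⟨C * μ.real Set.univ, by positivity, fun x => ?_⟩
  have : ‖lap μ c x‖ ≤ (C * expEnv α β x) * μ.real Set.univ := by
    refine norm_integral_le_of_norm_le_const ?_
    filter_upwards [hμ] with z hz
    rw [norm_mul]
    exact mul_le_mul (hcb z hz) (norm_cexp_mul_le_expEnv hz x) (norm_nonneg _) hC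
  linarith

theorem measurable_lap (hc : Measurable c) : Measurable (lap μ c) := by
  refine (StronglyMeasurable.integral_prod_right' (ν := μ)
    (f := fun p : ℝ × ℂ => c p.2 * Complex.exp (p.2 * p.1)) ?_).measurable
  exact Measurable.stronglyMeasurable (by fun_prop)

theorem lap_sub (hμ : ∀ᵐ z ∂μ, z ∈ strip α β) (hc : BddOn (strip α β) c)
    (hd : BddOn (strip α β) d) (x : ℝ) :
    lap μ (fun z => c z - d z) x = lap μ c x - lap μ d x := by
  simp only [lap, sub_mul]
  exact integral_sub (integrable_lap hμ hc x) (integrable_lap hμ hd x)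

omit [IsFiniteMeasure μ] in
theorem lap_const_mul (a : ℂ) (x : ℝ) : lap μ (fun z => a * c z) x = a * lap μ c x := by
  simp only [lap, mul_assoc]
  exact integral_const_mul _ _

variable {Ω : Type*} {mΩ : MeasurableSpace Ω} {P : Measure Ω} {ξ : Ω → ℝ}

theorem measurable_complexMGF [SFinite P] (hξ : Measurable ξ) : Measurable (complexMGF ξ P) := by
  refine (StronglyMeasurable.integral_prod_right' (ν := P)
    (f := fun p : ℂ × Ω => Complex.exp (p.1 * ξ p.2)) ?_).measurable
  exact Measurable.stronglyMeasurable (by fun_prop)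

theorem bddOn_complexMGF_add [SFinite P] (hξ : Measurable ξ) {k : ℝ}
    (hint : Integrable (fun ω => expEnv α β (ξ ω) * Real.exp (k * ξ ω)) P) :
    BddOn (strip α β) fun z => complexMGF ξ P (z + k) := by
  refine ⟨(measurable_complexMGF hξ).comp (by fun_prop),
    ∫ ω, expEnv α β (ξ ω) * Real.exp (k * ξ ω) ∂P,
    integral_nonneg fun ω => mul_nonneg (expEnv_pos _ _ _).le (Real.exp_pos _).le, fun z hz => ?_⟩
  refine norm_integral_le_of_norm_le hint (ae_of_all _ fun ω => ?_)
  rw [add_mul, Complex.exp_add, norm_mul]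
  refine mul_le_mul (norm_cexp_mul_le_expEnv hz _) (le_of_eq ?_) (norm_nonneg _) (expEnv_pos _ _ _).le
  rw [Complex.norm_exp, ← Complex.ofReal_mul, Complex.ofReal_re]

/-- Fubini, dominated by the envelope. The weight exp(kξ) is used with k = 0 and k = 1, for the mean
and for the mixed moment with the price ratio. -/
theorem integral_lap_add [SFinite P] (hμ : ∀ᵐ z ∂μ, z ∈ strip α β) (hc : BddOn (strip α β) c)
    (hξ : Measurable ξ) {k : ℝ}
    (hint : Integrable (fun ω => expEnv α β (ξ ω) * Real.exp (k * ξ ω)) P) (x : ℝ) :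
    ∫ ω, lap μ c (x + ξ ω) * Real.exp (k * ξ ω) ∂P =
      lap μ (fun z => c z * complexMGF ξ P (z + k)) x := by
  obtain ⟨hcm, C, hC, hcb⟩ := hc
  have hswap : Integrable (Function.uncurry fun (ω : Ω) (z : ℂ) =>
      c z * Complex.exp (z * (x + ξ ω : ℝ)) * Real.exp (k * ξ ω)) (P.prod μ) := by
    refine Integrable.mono' (g := fun p => C * expEnv α β x *
      (expEnv α β (ξ p.1) * Real.exp (k * ξ p.1))) ?_
      (Measurable.aestronglyMeasurable (by unfold Function.uncurry; fun_prop)) ?_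
    · exact (hint.const_mul (C * expEnv α β x)).comp_fst μ
    · filter_upwards [Measure.quasiMeasurePreserving_snd.ae hμ] with p hp
      simp only [Function.uncurry, norm_mul, Complex.norm_real, Real.norm_eq_abs, Real.abs_exp]
      have h1 := norm_cexp_mul_le_expEnv hp (x + ξ p.1)
      have h2 := expEnv_add_le α β x (ξ p.1)
      have h3 := hcb _ hp
      have h4 := Real.exp_pos (k * ξ p.1)
      calc _ ≤ C * (expEnv α β x * expEnv α β (ξ p.1)) * Real.exp (k * ξ p.1) := by
            gcongr; exact h1.trans h2
        _ = _ := by ring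
  calc _ = ∫ ω, ∫ z, c z * Complex.exp (z * (x + ξ ω : ℝ)) * Real.exp (k * ξ ω) ∂μ ∂P := by
        simp only [lap, integral_mul_const]
    _ = ∫ z, ∫ ω, c z * Complex.exp (z * (x + ξ ω : ℝ)) * Real.exp (k * ξ ω) ∂P ∂μ :=
        integral_integral_swap hswap
    _ = _ := by
        refine integral_congr_ae (ae_of_all _ fun z => ?_)
        simp only [complexMGF]
        rw [mul_right_comm, ← integral_const_mul]
        refine integral_congr_ae (ae_of_all _ fun ω => ?_)
        push_cast
        rw [show (z + k) * (ξ ω : ℂ) = z * ξ ω + k * ξ ω by ring, mul_add, Complex.exp_add,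
          Complex.exp_add]
        ring

end Lap

theorem _root_.MeasureTheory.Integrable.fun_sub {Ω E : Type*} [NormedAddCommGroup E]
    {mΩ : MeasurableSpace Ω} {P : Measure Ω} {f g : Ω → E} (hf : Integrable f P)
    (hg : Integrable g P) : Integrable (fun ω => f ω - g ω) P :=
  hf.sub hg

theorem _root_.MeasureTheory.MemLp.fun_sub {Ω E : Type*} [NormedAddCommGroup E]
    {mΩ : MeasurableSpace Ω} {P : Measure Ω} {p : ENNReal} {f g : Ω → E} (hf : MemLp f p P)
    (hg : MemLp g p P) : MemLp (fun ω => f ω - g ω) p P :=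
  hf.sub hg

theorem integrable_mul_of_memLp_two {Ω 𝕜 : Type*} [RCLike 𝕜] {mΩ : MeasurableSpace Ω}
    {P : Measure Ω} {f g : Ω → 𝕜} (hf : MemLp f 2 P) (hg : MemLp g 2 P) :
    Integrable (fun ω => f ω * g ω) P :=
  hf.integrable_mul hg

/-! ### Second moments of exponentials -/

/-- `ξ` is a random variable such that `exp(α ξ)`, `exp(β ξ)` and `exp ξ` are square integrable. -/
structure ExpMoments {Ω : Type*} {mΩ : MeasurableSpace Ω} (P : Measure Ω) (ξ : Ω → ℝ) (α β : ℝ) :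
    Prop where
  measurable : Measurable ξ
  left : Integrable (fun ω => Real.exp (2 * α * ξ ω)) P
  right : Integrable (fun ω => Real.exp (2 * β * ξ ω)) P
  two : Integrable (fun ω => Real.exp (2 * ξ ω)) P

namespace ExpMoments

variable {Ω : Type*} {mΩ : MeasurableSpace Ω} {P : Measure Ω} {ξ : Ω → ℝ} {α β : ℝ}

theorem memLp_exp_of_integrable {t : ℝ} (hξ : Measurable ξ)
    (h : Integrable (fun ω => Real.exp (2 * t * ξ ω)) P) :
    MemLp (fun ω => Real.exp (t * ξ ω)) 2 P := by
  rw [memLp_two_iff_integrable_sq (by fun_prop)]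
  refine h.congr (ae_of_all _ fun ω => ?_)
  simp only [← Real.exp_nat_mul]
  congr 1
  push_cast
  ring

theorem memLp_exp (h : ExpMoments P ξ α β) : MemLp (fun ω => Real.exp (ξ ω)) 2 P := by
  simpa using memLp_exp_of_integrable (t := 1) h.measurable (by simpa using h.two)

theorem memLp_expEnv (h : ExpMoments P ξ α β) : MemLp (fun ω => expEnv α β (ξ ω)) 2 P :=
  (memLp_exp_of_integrable h.measurable h.left).add (memLp_exp_of_integrable h.measurable h.right)

theorem memLp_cexp (h : ExpMoments P ξ α β) {z : ℂ} (hz : z ∈ strip α β) :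
    MemLp (fun ω => Complex.exp (z * ξ ω)) 2 P := by
  have := h.measurable
  refine h.memLp_expEnv.mono' (by fun_prop) (ae_of_all _ fun ω => norm_cexp_mul_le_expEnv hz _)

theorem memLp_cexp_one (h : ExpMoments P ξ α β) :
    MemLp (fun ω => Complex.exp (1 * ξ ω)) 2 P := by
  simpa using h.memLp_exp.ofReal (K := ℂ)

variable [IsProbabilityMeasure P]

theorem integrable_expEnv (h : ExpMoments P ξ α β) :
    Integrable (fun ω => expEnv α β (ξ ω) * Real.exp ((0 : ℝ) * ξ ω)) P := by
  simpa using h.memLp_expEnv.integrable one_le_two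

omit [IsProbabilityMeasure P] in
theorem integrable_expEnv_mul_exp (h : ExpMoments P ξ α β) :
    Integrable (fun ω => expEnv α β (ξ ω) * Real.exp ((1 : ℝ) * ξ ω)) P := by
  simpa using integrable_mul_of_memLp_two h.memLp_expEnv h.memLp_exp

theorem bddOn_complexMGF (h : ExpMoments P ξ α β) : BddOn (strip α β) (complexMGF ξ P) := by
  simpa using bddOn_complexMGF_add h.measurable h.integrable_expEnv

theorem bddOn_complexMGF_add_one (h : ExpMoments P ξ α β) :
    BddOn (strip α β) fun z => complexMGF ξ P (z + 1) := by
  simpa using bddOn_complexMGF_add h.measurable h.integrable_expEnv_mul_exp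

end ExpMoments

/-- The covariance of `exp(y ξ)` and `exp(z ξ)`. -/
noncomputable def expCov {Ω : Type*} {mΩ : MeasurableSpace Ω} (P : Measure Ω) (ξ : Ω → ℝ)
    (y z : ℂ) : ℂ :=
  complexMGF ξ P (y + z) - complexMGF ξ P y * complexMGF ξ P z

section ExpCov

variable {Ω : Type*} {mΩ : MeasurableSpace Ω} {P : Measure Ω} [IsProbabilityMeasure P] {ξ : Ω → ℝ}

theorem integral_centered_mul_centered {y z : ℂ}
    (hy : MemLp (fun ω => Complex.exp (y * ξ ω)) 2 P)
    (hz : MemLp (fun ω => Complex.exp (z * ξ ω)) 2 P) :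
    ∫ ω, (Complex.exp (y * ξ ω) - complexMGF ξ P y) *
      (Complex.exp (z * ξ ω) - complexMGF ξ P z) ∂P = expCov P ξ y z := by
  have hyz := integrable_mul_of_memLp_two hy hz
  have hy1 := hy.integrable one_le_two
  have hz1 := hz.integrable one_le_two
  have e : ∀ ω, (Complex.exp (y * ξ ω) - complexMGF ξ P y) *
      (Complex.exp (z * ξ ω) - complexMGF ξ P z) = Complex.exp (y * ξ ω) * Complex.exp (z * ξ ω)
      - (Complex.exp (y * ξ ω) * complexMGF ξ P z + complexMGF ξ P y * Complex.exp (z * ξ ω)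
      - complexMGF ξ P y * complexMGF ξ P z) := fun ω => by ring
  have i1 : ∫ ω, Complex.exp (y * ξ ω) * Complex.exp (z * ξ ω) ∂P = complexMGF ξ P (y + z) := by
    simp only [complexMGF, add_mul, Complex.exp_add]
  simp only [e]
  rw [integral_sub hyz (((hy1.mul_const _).fun_add (hz1.const_mul _)).fun_sub (integrable_const _)),
    integral_sub ((hy1.mul_const _).fun_add (hz1.const_mul _)) (integrable_const _),
    integral_add (hy1.mul_const _) (hz1.const_mul _), integral_mul_const, integral_const_mul, i1]
  simp only [integral_const, probReal_univ, one_smul, expCov, complexMGF]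
  ring

/-- The residual of the regression of `exp(z ξ)` on `exp ξ`. -/
noncomputable def expResid (P : Measure Ω) (ξ : Ω → ℝ) (z : ℂ) (x : ℝ) : ℂ :=
  Complex.exp (z * x) - complexMGF ξ P z -
    expCov P ξ z 1 / expCov P ξ 1 1 * (Complex.exp (1 * x) - complexMGF ξ P 1)

/-- The pairing is bilinear, without conjugation, because the square of a real residual unfolds into
an integral against Π ⊗ Π. The value is the usual residual covariance of a linear regression, which
becomes b. -/
theorem integral_expResid_mul_expResid {y z : ℂ}
    (hy : MemLp (fun ω => Complex.exp (y * ξ ω)) 2 P)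
    (hz : MemLp (fun ω => Complex.exp (z * ξ ω)) 2 P)
    (h1 : MemLp (fun ω => Complex.exp (1 * ξ ω)) 2 P) (h0 : expCov P ξ 1 1 ≠ 0) :
    ∫ ω, expResid P ξ y (ξ ω) * expResid P ξ z (ξ ω) ∂P =
      (expCov P ξ y z * expCov P ξ 1 1 - expCov P ξ y 1 * expCov P ξ z 1) / expCov P ξ 1 1 := by
  have hyc := hy.fun_sub (memLp_const (complexMGF ξ P y))
  have hzc := hz.fun_sub (memLp_const (complexMGF ξ P z))
  have h1c := h1.fun_sub (memLp_const (complexMGF ξ P 1))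
  set p := expCov P ξ y 1 / expCov P ξ 1 1
  set q := expCov P ξ z 1 / expCov P ξ 1 1
  have e : ∀ ω, expResid P ξ y (ξ ω) * expResid P ξ z (ξ ω) =
      ((Complex.exp (y * ξ ω) - complexMGF ξ P y) * (Complex.exp (z * ξ ω) - complexMGF ξ P z)
      - q * ((Complex.exp (y * ξ ω) - complexMGF ξ P y) *
          (Complex.exp (1 * ξ ω) - complexMGF ξ P 1)))
      - (p * ((Complex.exp (z * ξ ω) - complexMGF ξ P z) *
          (Complex.exp (1 * ξ ω) - complexMGF ξ P 1))
      - p * q * ((Complex.exp (1 * ξ ω) - complexMGF ξ P 1) *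
          (Complex.exp (1 * ξ ω) - complexMGF ξ P 1))) := fun ω => by
    simp only [expResid, p, q]; ring
  have iyz := integrable_mul_of_memLp_two hyc hzc
  have iy1 := (integrable_mul_of_memLp_two hyc h1c).const_mul q
  have iz1 := (integrable_mul_of_memLp_two hzc h1c).const_mul p
  have i11 := (integrable_mul_of_memLp_two h1c h1c).const_mul (p * q)
  simp only [e]
  rw [integral_sub (iyz.fun_sub iy1) (iz1.fun_sub i11), integral_sub iyz iy1, integral_sub iz1 i11,
    integral_const_mul, integral_const_mul, integral_const_mul,
    integral_centered_mul_centered hy hz, integral_centered_mul_centered hy h1,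
    integral_centered_mul_centered hz h1, integral_centered_mul_centered h1 h1]
  simp only [p, q]
  field_simp
  ring

end ExpCov

/-! ### Independence and one-period optimization -/

section Independence

variable {Ω : Type*} {mΩ : MeasurableSpace Ω} {P : Measure Ω}

/-- The joint law is the product of the laws, so Fubini lets Y be frozen while Z is averaged. This
takes the place of conditional expectations. -/
theorem integral_comp_of_indepFun [IsProbabilityMeasure P] {E F : Type*} [MeasurableSpace E] [MeasurableSpace F]
    {Y : Ω → E} {Z : Ω → F} (hY : Measurable Y) (hZ : Measurable Z) (h : IndepFun Y Z P)
    {G : E → F → ℝ} (hG : Measurable (Function.uncurry G))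
    (hint : Integrable (fun ω => G (Y ω) (Z ω)) P) :
    ∫ ω, G (Y ω) (Z ω) ∂P = ∫ ω, ∫ ω', G (Y ω) (Z ω') ∂P ∂P := by
  have hmap := (indepFun_iff_map_prod_eq_prod_map_map hY.aemeasurable hZ.aemeasurable).1 h
  have hYZ : Measurable fun ω => (Y ω, Z ω) := hY.prodMk hZ
  have hP1 : IsProbabilityMeasure (P.map Y) := Measure.isProbabilityMeasure_map hY.aemeasurable
  have hP2 : IsProbabilityMeasure (P.map Z) := Measure.isProbabilityMeasure_map hZ.aemeasurable
  have hint' : Integrable (Function.uncurry G) ((P.map Y).prod (P.map Z)) := by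
    rw [← hmap, integrable_map_measure hG.aestronglyMeasurable hYZ.aemeasurable]
    exact hint
  have e1 : ∫ ω, G (Y ω) (Z ω) ∂P = ∫ p, Function.uncurry G p ∂(P.map Y).prod (P.map Z) := by
    rw [← hmap, integral_map hYZ.aemeasurable hG.aestronglyMeasurable]
    rfl
  rw [e1, integral_prod _ hint', integral_map hY.aemeasurable
    (hG.stronglyMeasurable.integral_prod_right').aestronglyMeasurable]
  refine integral_congr_ae (ae_of_all _ fun ω => ?_)
  exact integral_map hZ.aemeasurable
    (hG.comp measurable_prodMk_left).aestronglyMeasurable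

theorem memLp_two_mul_of_indepFun {f g : Ω → ℝ} (hfg : IndepFun f g P) (hf : MemLp f 2 P)
    (hg : MemLp g 2 P) : MemLp (fun ω => f ω * g ω) 2 P := by
  refine (memLp_two_iff_integrable_sq
    (hf.aestronglyMeasurable.mul hg.aestronglyMeasurable)).2 ?_
  have := (hfg.comp (φ := fun x => x ^ 2) (ψ := fun x => x ^ 2) (by fun_prop)
    (by fun_prop)).integrable_mul hf.integrable_sq hg.integrable_sq
  refine this.congr (ae_of_all _ fun ω => ?_)
  simp [mul_pow]

theorem integrable_left_of_mul {f g : Ω → ℝ} (hfg : IndepFun f g P)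
    (hf : AEStronglyMeasurable f P) (hg : AEStronglyMeasurable g P) (hg0 : ¬ g =ᵐ[P] 0)
    (h : Integrable (fun ω => f ω * g ω) P) : Integrable f P :=
  hfg.integrable_left_of_integrable_op (· * ·) 1 one_ne_zero (fun x y => by simp) h hf hg hg0

/-- Admissibility only controls the product of position and price increment; independence of the
return lets square integrability be read off for the first factor alone. -/
theorem memLp_two_left_of_mul {f g : Ω → ℝ} (hfg : IndepFun f g P) (hf : Measurable f)
    (hg : MemLp g 2 P) (hg0 : 0 < ∫ ω, g ω ^ 2 ∂P)
    (h : MemLp (fun ω => f ω * g ω) 2 P) : MemLp f 2 P := by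
  rw [memLp_two_iff_integrable_sq hf.aestronglyMeasurable]
  have hi := hfg.comp (φ := fun x => x ^ 2) (ψ := fun x => x ^ 2) (by fun_prop) (by fun_prop)
  have h2 : Integrable (fun ω => f ω ^ 2 * g ω ^ 2) P := by
    refine h.integrable_sq.congr (ae_of_all _ fun ω => ?_)
    simp [mul_pow]
  refine integrable_left_of_mul hi (hf.pow_const 2).aestronglyMeasurable
    hg.integrable_sq.aestronglyMeasurable (fun h0 => ?_) h2
  have h0 : (fun ω => g ω ^ 2) =ᵐ[P] 0 := h0
  rw [integral_congr_ae h0] at hg0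
  simp at hg0

/-- Both cross terms with L vanish, and independence gives E[DWR] = E[DW]·E R and E[W²R²] = E W²·E
R². What remains is a quadratic form in D and W, in which the square is completed with respect to W.
-/
theorem integral_sq_one_period {D W R L : Ω → ℝ} (hD : MemLp D 2 P) (hW : Measurable W)
    (hR : MemLp R 2 P) (hWR : MemLp (fun ω => W ω * R ω) 2 P) (hL : MemLp L 2 P)
    (hind : IndepFun (fun ω => (D ω, W ω)) R P) (hDL : ∫ ω, D ω * L ω ∂P = 0)
    (hWL : ∫ ω, W ω * R ω * L ω ∂P = 0) (hB : 0 < ∫ ω, R ω ^ 2 ∂P) :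
    ∫ ω, (D ω + W ω * R ω + L ω) ^ 2 ∂P =
      ∫ ω, L ω ^ 2 ∂P +
        (1 - (∫ ω, R ω ∂P) ^ 2 / ∫ ω, R ω ^ 2 ∂P) * ∫ ω, D ω ^ 2 ∂P +
        (∫ ω, R ω ^ 2 ∂P) *
          ∫ ω, (W ω + (∫ ω, R ω ∂P) / (∫ ω, R ω ^ 2 ∂P) * D ω) ^ 2 ∂P := by
  have hWi : IndepFun W R P := hind.comp (φ := Prod.snd) (ψ := id) measurable_snd measurable_id
  have hW2 : MemLp W 2 P := memLp_two_left_of_mul hWi hW hR hB hWR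
  set A := ∫ ω, R ω ∂P with hA
  set B := ∫ ω, R ω ^ 2 ∂P with hBdef
  have hDW : Integrable (fun ω => D ω * W ω) P := integrable_mul_of_memLp_two hD hW2
  have iDWR : ∫ ω, D ω * (W ω * R ω) ∂P = (∫ ω, D ω * W ω ∂P) * A := by
    have := (hind.comp (φ := fun p : ℝ × ℝ => p.1 * p.2) (ψ := id) (by fun_prop)
      measurable_id).integral_mul_eq_mul_integral hDW.aestronglyMeasurable
      hR.aestronglyMeasurable
    rw [hA]
    refine Eq.trans (integral_congr_ae (ae_of_all _ fun ω => ?_)) this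
    simp [mul_assoc]
  have iWR : ∫ ω, (W ω * R ω) ^ 2 ∂P = (∫ ω, W ω ^ 2 ∂P) * B := by
    have := (hWi.comp (φ := fun x => x ^ 2) (ψ := fun x => x ^ 2) (by fun_prop)
      (by fun_prop)).integral_mul_eq_mul_integral hW2.integrable_sq.aestronglyMeasurable
      hR.integrable_sq.aestronglyMeasurable
    refine Eq.trans (integral_congr_ae (ae_of_all _ fun ω => ?_)) this
    simp [mul_pow]
  have a1 := hD.integrable_sq
  have a2 := hWR.integrable_sq
  have a3 := hL.integrable_sq
  have a4 := (integrable_mul_of_memLp_two hD hWR).const_mul 2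
  have a5 := (integrable_mul_of_memLp_two hD hL).const_mul 2
  have a6 := (integrable_mul_of_memLp_two hWR hL).const_mul 2
  have lhs : ∫ ω, (D ω + W ω * R ω + L ω) ^ 2 ∂P =
      ∫ ω, D ω ^ 2 ∂P + (∫ ω, W ω ^ 2 ∂P) * B + ∫ ω, L ω ^ 2 ∂P +
        2 * ((∫ ω, D ω * W ω ∂P) * A) := by
    have e : ∀ ω, (D ω + W ω * R ω + L ω) ^ 2 = D ω ^ 2 + (W ω * R ω) ^ 2 + L ω ^ 2 +
        2 * (D ω * (W ω * R ω)) + 2 * (D ω * L ω) + 2 * (W ω * R ω * L ω) := fun ω => by ring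
    simp only [e]
    rw [integral_add ((((a1.fun_add a2).fun_add a3).fun_add a4).fun_add a5) a6,
      integral_add (((a1.fun_add a2).fun_add a3).fun_add a4) a5,
      integral_add ((a1.fun_add a2).fun_add a3) a4, integral_add (a1.fun_add a2) a3,
      integral_add a1 a2, integral_const_mul, integral_const_mul, integral_const_mul, hDL, hWL,
      iDWR, iWR]
    ring
  have rhs : ∫ ω, (W ω + A / B * D ω) ^ 2 ∂P =
      ∫ ω, W ω ^ 2 ∂P + 2 * (A / B) * ∫ ω, D ω * W ω ∂P + (A / B) ^ 2 * ∫ ω, D ω ^ 2 ∂P := by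
    have e : ∀ ω, (W ω + A / B * D ω) ^ 2 =
        W ω ^ 2 + 2 * (A / B) * (D ω * W ω) + (A / B) ^ 2 * D ω ^ 2 := fun ω => by ring
    simp only [e]
    rw [integral_add (hW2.integrable_sq.fun_add (hDW.const_mul _)) (a1.const_mul _),
      integral_add hW2.integrable_sq (hDW.const_mul _), integral_const_mul, integral_const_mul]
  rw [lhs, rhs]
  field_simp
  ring

end Independence

/-! ### Processes with independent increments -/

/-- The standing assumptions on the process `X`, with real exponential moments at `2`, `2α`, `2β`. -/
structure Market {Ω : Type*} {mΩ : MeasurableSpace Ω} (P : Measure Ω) (N : ℕ)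
    (ℱ : Filtration ℕ mΩ) (X : ℕ → Ω → ℝ) (α β : ℝ) : Prop where
  zero : ∀ ω, X 0 ω = 0
  adapted : ∀ n ≤ N, Measurable[ℱ n] (X n)
  indep : ∀ n ∈ Finset.Icc 1 N,
    Indep (MeasurableSpace.comap (incr X n) inferInstance) (ℱ (n - 1)) P
  nondet : ∀ n ∈ Finset.Icc 1 N, ¬ ∃ c : ℝ, ∀ᵐ ω ∂P, incr X n ω = c
  moments : ExpMoments P (X N) α β

namespace Market

variable {Ω : Type*} {mΩ : MeasurableSpace Ω} {P : Measure Ω} [IsProbabilityMeasure P] {N : ℕ}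
  {ℱ : Filtration ℕ mΩ} {X : ℕ → Ω → ℝ} {α β : ℝ}

section Basic

omit [IsProbabilityMeasure P]

theorem measurable_incr (M : Market P N ℱ X α β) {n : ℕ} (hn : n < N) :
    Measurable (incr X (n + 1)) :=
  ((M.adapted (n + 1) hn).mono (ℱ.le _) le_rfl).sub
    ((M.adapted n hn.le).mono (ℱ.le _) le_rfl)

theorem measurable_X (M : Market P N ℱ X α β) {n : ℕ} (hn : n ≤ N) : Measurable (X n) :=
  (M.adapted n hn).mono (ℱ.le _) le_rfl

theorem indepFun (M : Market P N ℱ X α β) {n : ℕ} (hn : n < N) {E : Type*} [mE : MeasurableSpace E]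
    {Y : Ω → E} (hY : Measurable[ℱ n] Y) : IndepFun Y (incr X (n + 1)) P := by
  have h := M.indep (n + 1) (by simp; omega)
  rw [IndepFun_iff_Indep]
  exact indep_of_indep_of_le_left h.symm hY.comap_le

theorem X_succ (X : ℕ → Ω → ℝ) (n : ℕ) (ω : Ω) : X (n + 1) ω = X n ω + incr X (n + 1) ω := by
  simp [incr]

end Basic

/-- The exponential of the sum is a product of two independent factors, neither of which vanishes,
so integrability of the product passes to each factor. -/
theorem integrable_exp_step (M : Market P N ℱ X α β) {n : ℕ} (hn : n < N) {t : ℝ}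
    (h : Integrable (fun ω => Real.exp (t * X (n + 1) ω)) P) :
    Integrable (fun ω => Real.exp (t * X n ω)) P ∧
      Integrable (fun ω => Real.exp (t * incr X (n + 1) ω)) P := by
  have hi : IndepFun (fun ω => Real.exp (t * X n ω)) (fun ω => Real.exp (t * incr X (n + 1) ω)) P :=
    (M.indepFun hn (M.adapted n hn.le)).comp (φ := fun x => Real.exp (t * x))
      (ψ := fun x => Real.exp (t * x)) (by fun_prop) (by fun_prop)
  have m1 := M.measurable_X hn.le
  have m2 := M.measurable_incr hn
  have h' : Integrable (fun ω => Real.exp (t * X n ω) * Real.exp (t * incr X (n + 1) ω)) P := by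
    simpa only [X_succ X n, mul_add, Real.exp_add] using h
  have hne : ∀ f : Ω → ℝ, ¬ (fun ω => Real.exp (f ω)) =ᵐ[P] 0 := fun f h0 => by
    obtain ⟨ω, hω⟩ := h0.exists
    exact (Real.exp_pos _).ne' hω
  refine ⟨integrable_left_of_mul hi (by fun_prop) (by fun_prop) (hne _) h',
    integrable_left_of_mul hi.symm (by fun_prop) (by fun_prop) (hne _) ?_⟩
  simpa only [mul_comm] using h'

theorem integrable_exp (M : Market P N ℱ X α β) {t : ℝ}
    (h : Integrable (fun ω => Real.exp (t * X N ω)) P) {n : ℕ} (hn : n ≤ N) :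
    Integrable (fun ω => Real.exp (t * X n ω)) P := by
  induction hn using Nat.decreasingInduction with
  | self => exact h
  | of_succ k hk ih => exact (M.integrable_exp_step hk ih).1

theorem moments_X (M : Market P N ℱ X α β) {n : ℕ} (hn : n ≤ N) : ExpMoments P (X n) α β :=
  ⟨M.measurable_X hn, M.integrable_exp M.moments.left hn, M.integrable_exp M.moments.right hn,
    M.integrable_exp M.moments.two hn⟩

theorem moments_incr (M : Market P N ℱ X α β) {n : ℕ} (hn : n < N) :
    ExpMoments P (incr X (n + 1)) α β :=
  ⟨M.measurable_incr hn, (M.integrable_exp_step hn (M.moments_X hn).left).2,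
    (M.integrable_exp_step hn (M.moments_X hn).right).2,
    (M.integrable_exp_step hn (M.moments_X hn).two).2⟩

omit [IsProbabilityMeasure P] in
theorem _root_.DiscreteHedging.m_succ (z : ℂ) (n : ℕ) :
    m P X z (n + 1) = complexMGF (incr X (n + 1)) P z := by
  simp [m]

/-- Factorization of integrals of independent functions needs only measurability here, so w is
unrestricted; the use is w = y + z, which need not lie in the strip. -/
theorem complexMGF_X (M : Market P N ℱ X α β) (w : ℂ) {n : ℕ} (hn : n ≤ N) :
    complexMGF (X n) P w = ∏ l ∈ Finset.Icc 1 n, m P X w l := by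
  induction n with
  | zero => simp [complexMGF, M.zero]
  | succ n ih =>
    have m1 := M.measurable_X (Nat.lt_of_succ_le hn).le
    have m2 := M.measurable_incr (Nat.lt_of_succ_le hn)
    rw [Finset.prod_Icc_succ_top (by omega), ← ih (by omega), m_succ]
    have := ((M.indepFun (Nat.lt_of_succ_le hn) (M.adapted n (by omega))).comp
      (φ := fun x : ℝ => Complex.exp (w * x)) (ψ := fun x : ℝ => Complex.exp (w * x))
      (by fun_prop) (by fun_prop)).integral_fun_mul_eq_mul_integral
      (Measurable.aestronglyMeasurable (by fun_prop))
      (Measurable.aestronglyMeasurable (by fun_prop))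
    simp only [Function.comp_def] at this
    simp only [complexMGF]
    rw [← this]
    refine integral_congr_ae (ae_of_all _ fun ω => ?_)
    simp only [X_succ X n, Complex.ofReal_add, mul_add, Complex.exp_add]

/-! #### Moments of the returns -/

/-- The return `exp(ΔX_{n+1}) - 1`. -/
noncomputable def _root_.DiscreteHedging.ret (X : ℕ → Ω → ℝ) (n : ℕ) (ω : Ω) : ℝ :=
  Real.exp (incr X (n + 1) ω) - 1

/-- The variance of `exp(ΔX_{n+1})`. -/
noncomputable def _root_.DiscreteHedging.retVar (P : Measure Ω) (X : ℕ → Ω → ℝ) (n : ℕ) : ℝ :=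
  mgf (incr X (n + 1)) P 2 - mgf (incr X (n + 1)) P 1 ^ 2

omit [IsProbabilityMeasure P] in
theorem m_one (n : ℕ) : m P X 1 (n + 1) = (mgf (incr X (n + 1)) P 1 : ℝ) := by
  rw [m_succ, ← complexMGF_ofReal, Complex.ofReal_one]

omit [IsProbabilityMeasure P] in
theorem m_two (n : ℕ) : m P X 2 (n + 1) = (mgf (incr X (n + 1)) P 2 : ℝ) := by
  rw [m_succ, ← complexMGF_ofReal, Complex.ofReal_ofNat]

theorem memLp_ret (M : Market P N ℱ X α β) {n : ℕ} (hn : n < N) : MemLp (ret X n) 2 P :=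
  (M.moments_incr hn).memLp_exp.fun_sub (memLp_const 1)

theorem integral_ret (M : Market P N ℱ X α β) {n : ℕ} (hn : n < N) :
    ∫ ω, ret X n ω ∂P = mgf (incr X (n + 1)) P 1 - 1 := by
  simp only [ret]
  rw [integral_sub ((M.moments_incr hn).memLp_exp.integrable one_le_two) (integrable_const _)]
  simp [mgf]

theorem integral_ret_sq (M : Market P N ℱ X α β) {n : ℕ} (hn : n < N) :
    ∫ ω, ret X n ω ^ 2 ∂P =
      mgf (incr X (n + 1)) P 2 - 2 * mgf (incr X (n + 1)) P 1 + 1 := by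
  have e : ∀ ω, ret X n ω ^ 2 = Real.exp (2 * incr X (n + 1) ω) -
      2 * Real.exp (1 * incr X (n + 1) ω) + 1 := fun ω => by
    rw [ret, two_mul, Real.exp_add, one_mul]; ring
  have h1 := (M.moments_incr hn).memLp_exp.integrable one_le_two
  have h1 : Integrable (fun ω => Real.exp (1 * incr X (n + 1) ω)) P := by simpa using h1
  simp only [e]
  rw [integral_add ((M.moments_incr hn).two.fun_sub (h1.const_mul 2)) (integrable_const _),
    integral_sub (M.moments_incr hn).two (h1.const_mul 2), integral_const_mul]
  simp [mgf]

/-- Zero variance would make exp(ΔX), hence ΔX, almost surely constant. This is where nondegeneracy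
enters, and it keeps the denominators of g, λ, a and b away from zero. -/
theorem retVar_pos (M : Market P N ℱ X α β) {n : ℕ} (hn : n < N) : 0 < retVar P X n := by
  have hL := (M.moments_incr hn).memLp_exp
  have hv : variance (fun ω => Real.exp (incr X (n + 1) ω)) P = retVar P X n := by
    rw [variance_eq_sub hL, retVar]
    simp only [mgf, one_mul, Pi.pow_apply, ← Real.exp_nat_mul]
    push_cast
    rfl
  refine lt_of_le_of_ne (hv ▸ variance_nonneg _ _) fun h0 => ?_
  refine M.nondet (n + 1) (by simp; omega) ⟨Real.log (∫ ω, Real.exp (incr X (n + 1) ω) ∂P), ?_⟩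
  filter_upwards [ae_eq_integral_of_variance_eq_zero hL (by rw [hv, ← h0])] with ω hω
  rw [← hω, Real.log_exp]

theorem integral_ret_sq_eq (M : Market P N ℱ X α β) {n : ℕ} (hn : n < N) :
    ∫ ω, ret X n ω ^ 2 ∂P = retVar P X n + (mgf (incr X (n + 1)) P 1 - 1) ^ 2 := by
  rw [M.integral_ret_sq hn, retVar]; ring

theorem integral_ret_sq_pos (M : Market P N ℱ X α β) {n : ℕ} (hn : n < N) :
    0 < ∫ ω, ret X n ω ^ 2 ∂P := by
  rw [M.integral_ret_sq_eq hn]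
  have := M.retVar_pos hn
  positivity

/-! #### The coefficients `g` and `h` -/

omit [IsProbabilityMeasure P] in
theorem _root_.DiscreteHedging.expCov_one_one (n : ℕ) :
    expCov P (incr X (n + 1)) 1 1 = (retVar P X n : ℝ) := by
  rw [expCov, ← m_succ, ← m_succ, one_add_one_eq_two, m_one, m_two, retVar]
  push_cast
  ring

theorem bddOn_m (M : Market P N ℱ X α β) {n : ℕ} (hn : n < N) :
    BddOn (strip α β) fun z => m P X z (n + 1) := by
  simpa only [m_succ] using (M.moments_incr hn).bddOn_complexMGF

theorem bddOn_m_add_one (M : Market P N ℱ X α β) {n : ℕ} (hn : n < N) :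
    BddOn (strip α β) fun z => m P X (z + 1) (n + 1) := by
  simpa only [m_succ] using (M.moments_incr hn).bddOn_complexMGF_add_one

theorem bddOn_g (M : Market P N ℱ X α β) {n : ℕ} (hn : n < N) :
    BddOn (strip α β) fun z => g P X z (n + 1) := by
  simp only [g, div_eq_mul_inv]
  exact ((M.bddOn_m_add_one hn).sub ((BddOn.const _).mul (M.bddOn_m hn))).mul (BddOn.const _)

theorem bddOn_h (M : Market P N ℱ X α β) (n : ℕ) : BddOn (strip α β) fun z => h P X N z n := by
  simp only [h]
  refine BddOn.prod _ fun i hi => ?_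
  obtain ⟨k, rfl⟩ : ∃ k, i = k + 1 := ⟨i - 1, by simp at hi; omega⟩
  have hk : k < N := by simp at hi; omega
  exact (M.bddOn_m hk).sub ((M.bddOn_g hk).mul (BddOn.const _))

omit [IsProbabilityMeasure P] in
theorem _root_.DiscreteHedging.h_eq_mul_succ (z : ℂ) {n : ℕ} (hn : n < N) :
    h P X N z n = (m P X z (n + 1) - g P X z (n + 1) * (m P X 1 (n + 1) - 1)) *
      h P X N z (n + 1) := by
  simp only [h]
  rw [← Finset.mul_prod_Ioc_eq_prod_Icc (by omega)]
  have : Finset.Ioc (n + 1) N = Finset.Icc (n + 1 + 1) N := by ext; simp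
  rw [this]

end Market

/-! ### The value function and the residuals -/

/-- A complex measure `u dμ` on the strip whose transform `∫ exp(z x) u(z) μ(dz)` is real. -/
structure RealSpectrum (μ : Measure ℂ) (u : ℂ → ℂ) (α β : ℝ) : Prop where
  ae_mem : ∀ᵐ z ∂μ, z ∈ strip α β
  measurable : Measurable u
  norm_eq_one : ∀ z, ‖u z‖ = 1
  im_eq_zero : ∀ x, (lap μ u x).im = 0

section Defs

variable {Ω : Type*} {mΩ : MeasurableSpace Ω}

/-- `∫ h(z,n) exp(z x) u(z) μ(dz)`, which is `H_n` on `{log S_n = x}`. -/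
noncomputable def eta (P : Measure Ω) (X : ℕ → Ω → ℝ) (N : ℕ) (μ : Measure ℂ) (u : ℂ → ℂ) (n : ℕ)
    (x : ℝ) : ℂ :=
  lap μ (fun z => h P X N z n * u z) x

/-- `∫ g(z,n) h(z,n) exp(z x) u(z) μ(dz)`, which is `ξ_n S_{n-1}` on `{log S_{n-1} = x}`. -/
noncomputable def chi (P : Measure Ω) (X : ℕ → Ω → ℝ) (N : ℕ) (μ : Measure ℂ) (u : ℂ → ℂ) (n : ℕ)
    (x : ℝ) : ℂ :=
  lap μ (fun z => g P X z n * (h P X N z n * u z)) x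

/-- The real part of `eta`. -/
noncomputable def etaR (P : Measure Ω) (X : ℕ → Ω → ℝ) (N : ℕ) (μ : Measure ℂ) (u : ℂ → ℂ) (n : ℕ)
    (x : ℝ) : ℝ :=
  (eta P X N μ u n x).re

/-- The real part of `chi`. -/
noncomputable def chiR (P : Measure Ω) (X : ℕ → Ω → ℝ) (N : ℕ) (μ : Measure ℂ) (u : ℂ → ℂ) (n : ℕ)
    (x : ℝ) : ℝ :=
  (chi P X N μ u n x).re

/-- The part of the change of the value process in period `n + 1` that the asset does not explain,
as a function of `x = log S_n` and `y = ΔX_{n+1}`. -/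
noncomputable def resid (P : Measure Ω) (X : ℕ → Ω → ℝ) (N : ℕ) (μ : Measure ℂ) (u : ℂ → ℂ) (n : ℕ)
    (x y : ℝ) : ℝ :=
  etaR P X N μ u (n + 1) (x + y) - etaR P X N μ u n x -
    chiR P X N μ u (n + 1) x * (Real.exp y - 1)

end Defs

namespace Market

variable {Ω : Type*} {mΩ : MeasurableSpace Ω} {P : Measure Ω} [IsProbabilityMeasure P] {N : ℕ}
  {ℱ : Filtration ℕ mΩ} {X : ℕ → Ω → ℝ} {α β : ℝ} {μ : Measure ℂ} [IsFiniteMeasure μ] {u : ℂ → ℂ}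

omit [IsFiniteMeasure μ] in
theorem _root_.DiscreteHedging.RealSpectrum.bddOn (U : RealSpectrum μ u α β) :
    BddOn (strip α β) u :=
  ⟨U.measurable, 1, zero_le_one, fun z _ => (U.norm_eq_one z).le⟩

omit [IsFiniteMeasure μ] in
theorem bddOn_h_mul (M : Market P N ℱ X α β) (U : RealSpectrum μ u α β) (n : ℕ) :
    BddOn (strip α β) fun z => h P X N z n * u z :=
  (M.bddOn_h n).mul U.bddOn

omit [IsFiniteMeasure μ] in
theorem bddOn_g_mul (M : Market P N ℱ X α β) (U : RealSpectrum μ u α β) {n : ℕ} (hn : n < N) :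
    BddOn (strip α β) fun z => g P X z (n + 1) * (h P X N z (n + 1) * u z) :=
  (M.bddOn_g hn).mul (M.bddOn_h_mul U _)

theorem integral_eta (M : Market P N ℱ X α β) (U : RealSpectrum μ u α β) {n : ℕ} (hn : n < N)
    (x : ℝ) : ∫ ω, eta P X N μ u (n + 1) (x + incr X (n + 1) ω) ∂P =
      lap μ (fun z => h P X N z (n + 1) * u z * m P X z (n + 1)) x := by
  have := integral_lap_add U.ae_mem (M.bddOn_h_mul U (n + 1)) (M.measurable_incr hn)
    (M.moments_incr hn).integrable_expEnv x
  simpa [← m_succ, eta] using this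

theorem integral_eta_mul_exp (M : Market P N ℱ X α β) (U : RealSpectrum μ u α β) {n : ℕ}
    (hn : n < N) (x : ℝ) :
    ∫ ω, eta P X N μ u (n + 1) (x + incr X (n + 1) ω) * Real.exp (incr X (n + 1) ω) ∂P =
      lap μ (fun z => h P X N z (n + 1) * u z * m P X (z + 1) (n + 1)) x := by
  have := integral_lap_add U.ae_mem (M.bddOn_h_mul U (n + 1)) (M.measurable_incr hn)
    (M.moments_incr hn).integrable_expEnv_mul_exp x
  simpa [← m_succ, eta] using this

/-- By linearity in z, χ inherits from g the role of a regression coefficient: times the variance it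
is the covariance of the next value with the price ratio. -/
theorem chi_mul_retVar (M : Market P N ℱ X α β) (U : RealSpectrum μ u α β) {n : ℕ} (hn : n < N)
    (x : ℝ) : chi P X N μ u (n + 1) x * retVar P X n =
      ∫ ω, eta P X N μ u (n + 1) (x + incr X (n + 1) ω) * Real.exp (incr X (n + 1) ω) ∂P -
        m P X 1 (n + 1) * ∫ ω, eta P X N μ u (n + 1) (x + incr X (n + 1) ω) ∂P := by
  have hb := M.bddOn_h_mul U (n + 1)
  rw [M.integral_eta U hn, M.integral_eta_mul_exp U hn, ← lap_const_mul,
    ← lap_sub U.ae_mem (hb.mul (M.bddOn_m_add_one hn))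
      ((BddOn.const _).mul (hb.mul (M.bddOn_m hn))), mul_comm, chi, ← lap_const_mul]
  have h0 : m P X 2 (n + 1) - m P X 1 (n + 1) ^ 2 = (retVar P X n : ℝ) := by
    rw [m_one, m_two, retVar]; push_cast; ring
  have hv : ((retVar P X n : ℝ) : ℂ) ≠ 0 := by exact_mod_cast (M.retVar_pos hn).ne'
  congr 1
  funext z
  rw [g, h0]
  field_simp

theorem eta_eq (M : Market P N ℱ X α β) (U : RealSpectrum μ u α β) {n : ℕ} (hn : n < N)
    (x : ℝ) : eta P X N μ u n x =
      ∫ ω, eta P X N μ u (n + 1) (x + incr X (n + 1) ω) ∂P -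
        (m P X 1 (n + 1) - 1) * chi P X N μ u (n + 1) x := by
  have hb := M.bddOn_h_mul U (n + 1)
  rw [M.integral_eta U hn, chi, ← lap_const_mul, ← lap_sub U.ae_mem (hb.mul (M.bddOn_m hn))
    ((BddOn.const _).mul (M.bddOn_g_mul U hn)), eta]
  congr 1
  funext z
  rw [h_eq_mul_succ z hn]
  ring

omit [IsProbabilityMeasure P] [IsFiniteMeasure μ] in
theorem eta_terminal (x : ℝ) : eta P X N μ u N x = lap μ u x := by
  simp [eta, h]

theorem _root_.DiscreteHedging.ofReal_re_of_im_eq_zero {w : ℂ} (hw : w.im = 0) :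
    ((w.re : ℝ) : ℂ) = w :=
  Complex.ext rfl (by simp [hw])

/-- The covariance formula for χ involves only real quantities once the next value is real, and the
variance is a nonzero real number. -/
theorem chi_im_of_eta_im (M : Market P N ℱ X α β) (U : RealSpectrum μ u α β) {n : ℕ} (hn : n < N)
    (hη : ∀ x, (eta P X N μ u (n + 1) x).im = 0) (x : ℝ) : (chi P X N μ u (n + 1) x).im = 0 := by
  have hη' : ∀ x, eta P X N μ u (n + 1) x = (etaR P X N μ u (n + 1) x : ℝ) := fun x =>
    (ofReal_re_of_im_eq_zero (hη x)).symm
  have h1 := M.chi_mul_retVar U hn x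
  simp only [m_one, hη' (x + _), ← Complex.ofReal_mul, integral_complex_ofReal,
    ← Complex.ofReal_sub] at h1
  have h2 := congrArg Complex.im h1
  rw [Complex.im_mul_ofReal, Complex.ofReal_im] at h2
  exact (mul_eq_zero.1 h2).resolve_right (M.retVar_pos hn).ne'

/-- Backward induction from the real payoff. Reality thus comes from f alone; no conjugation
symmetry of the measure has to be established. -/
theorem eta_im (M : Market P N ℱ X α β) (U : RealSpectrum μ u α β) {n : ℕ} (hn : n ≤ N) :
    ∀ x, (eta P X N μ u n x).im = 0 := by
  induction hn using Nat.decreasingInduction with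
  | self => exact fun x => by rw [eta_terminal]; exact U.im_eq_zero x
  | of_succ n hn ih =>
    intro x
    have ih' : ∀ x, eta P X N μ u (n + 1) x = (etaR P X N μ u (n + 1) x : ℝ) := fun x =>
      (ofReal_re_of_im_eq_zero (ih x)).symm
    rw [M.eta_eq U hn, ← ofReal_re_of_im_eq_zero (M.chi_im_of_eta_im U hn ih x), m_one]
    simp only [ih' (x + _), integral_complex_ofReal]
    simp

theorem chi_im (M : Market P N ℱ X α β) (U : RealSpectrum μ u α β) {n : ℕ} (hn : n < N) (x : ℝ) :
    (chi P X N μ u (n + 1) x).im = 0 :=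
  M.chi_im_of_eta_im U hn (M.eta_im U hn) x

theorem eta_re (M : Market P N ℱ X α β) (U : RealSpectrum μ u α β) {n : ℕ} (hn : n ≤ N) (x : ℝ) :
    ((etaR P X N μ u n x : ℝ) : ℂ) = eta P X N μ u n x :=
  ofReal_re_of_im_eq_zero (M.eta_im U hn x)

theorem chi_re (M : Market P N ℱ X α β) (U : RealSpectrum μ u α β) {n : ℕ} (hn : n < N) (x : ℝ) :
    ((chiR P X N μ u (n + 1) x : ℝ) : ℂ) = chi P X N μ u (n + 1) x :=
  ofReal_re_of_im_eq_zero (M.chi_im U hn x)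

/-! #### Size and measurability -/

theorem measurable_eta (M : Market P N ℱ X α β) (U : RealSpectrum μ u α β) (n : ℕ) :
    Measurable (etaR P X N μ u n) :=
  Complex.measurable_re.comp (measurable_lap (M.bddOn_h_mul U n).measurable)

theorem measurable_chi (M : Market P N ℱ X α β) (U : RealSpectrum μ u α β) {n : ℕ} (hn : n < N) :
    Measurable (chiR P X N μ u (n + 1)) :=
  Complex.measurable_re.comp (measurable_lap (M.bddOn_g_mul U hn).measurable)

theorem measurable_resid (M : Market P N ℱ X α β) (U : RealSpectrum μ u α β) {n : ℕ} (hn : n < N) :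
    Measurable (Function.uncurry (resid P X N μ u n)) := by
  have h1 := M.measurable_eta U (n + 1)
  have h2 := M.measurable_eta U n
  have h3 := M.measurable_chi U hn
  unfold Function.uncurry resid
  exact ((h1.comp (by fun_prop)).sub (h2.comp (by fun_prop))).sub
    ((h3.comp (by fun_prop)).mul (by fun_prop))

theorem memLp_lap (M : Market P N ℱ X α β) (U : RealSpectrum μ u α β) {c : ℂ → ℂ}
    (hc : BddOn (strip α β) c) {n : ℕ} (hn : n ≤ N) (x : ℝ) :
    MemLp (fun ω => (lap μ c (x + X n ω)).re) 2 P := by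
  obtain ⟨C, hC, hb⟩ := norm_lap_le U.ae_mem hc
  have hm : Measurable fun ω => (lap μ c (x + X n ω)).re :=
    Complex.measurable_re.comp ((measurable_lap hc.measurable).comp
      ((M.measurable_X hn).const_add x))
  refine ((M.moments_X hn).memLp_expEnv.const_mul (C * expEnv α β x)).mono'
    hm.aestronglyMeasurable (ae_of_all _ fun ω => ?_)
  calc ‖(lap μ c (x + X n ω)).re‖ ≤ ‖lap μ c (x + X n ω)‖ := Complex.abs_re_le_norm _
    _ ≤ C * expEnv α β (x + X n ω) := hb _
    _ ≤ C * (expEnv α β x * expEnv α β (X n ω)) := by gcongr; exact expEnv_add_le _ _ _ _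
    _ = _ := by ring

theorem memLp_eta (M : Market P N ℱ X α β) (U : RealSpectrum μ u α β) {n : ℕ} (hn : n ≤ N)
    (x : ℝ) : MemLp (fun ω => etaR P X N μ u n (x + X n ω)) 2 P :=
  M.memLp_lap U (M.bddOn_h_mul U n) hn x

theorem memLp_chi_mul_ret (M : Market P N ℱ X α β) (U : RealSpectrum μ u α β) {n : ℕ} (hn : n < N)
    (x : ℝ) : MemLp (fun ω => chiR P X N μ u (n + 1) (x + X n ω) * ret X n ω) 2 P := by
  have hm : Measurable[ℱ n] fun ω => chiR P X N μ u (n + 1) (x + X n ω) :=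
    (M.measurable_chi U hn).comp ((M.adapted n hn.le).const_add x)
  refine memLp_two_mul_of_indepFun ?_ (M.memLp_lap U (M.bddOn_g_mul U hn) hn.le x) (M.memLp_ret hn)
  exact (M.indepFun hn hm).comp (φ := id) (ψ := fun y => Real.exp y - 1) measurable_id (by fun_prop)

theorem memLp_resid (M : Market P N ℱ X α β) (U : RealSpectrum μ u α β) {n : ℕ} (hn : n < N)
    (x : ℝ) : MemLp (fun ω => resid P X N μ u n (x + X n ω) (incr X (n + 1) ω)) 2 P := by
  have h1 := M.memLp_eta U (n := n + 1) hn x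
  simp only [X_succ X n, ← add_assoc] at h1
  exact (h1.fun_sub (M.memLp_eta U hn.le x)).fun_sub (M.memLp_chi_mul_ret U hn x)

theorem memLp_eta_incr (M : Market P N ℱ X α β) (U : RealSpectrum μ u α β) {n : ℕ} (hn : n < N)
    (x : ℝ) : MemLp (fun ω => etaR P X N μ u (n + 1) (x + incr X (n + 1) ω)) 2 P := by
  obtain ⟨C, hC, hb⟩ := norm_lap_le U.ae_mem (M.bddOn_h_mul U (n + 1))
  have hm : Measurable fun ω => etaR P X N μ u (n + 1) (x + incr X (n + 1) ω) :=
    (M.measurable_eta U (n + 1)).comp ((M.measurable_incr hn).const_add x)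
  refine ((M.moments_incr hn).memLp_expEnv.const_mul (C * expEnv α β x)).mono'
    hm.aestronglyMeasurable (ae_of_all _ fun ω => ?_)
  calc ‖etaR P X N μ u (n + 1) (x + incr X (n + 1) ω)‖
      ≤ ‖eta P X N μ u (n + 1) (x + incr X (n + 1) ω)‖ := Complex.abs_re_le_norm _
    _ ≤ C * expEnv α β (x + incr X (n + 1) ω) := hb _
    _ ≤ C * (expEnv α β x * expEnv α β (incr X (n + 1) ω)) := by
      gcongr; exact expEnv_add_le _ _ _ _
    _ = _ := by ring

/-- The normal equations of the one-period regression, in real form: the first fixes the slope, the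
second the intercept. -/
theorem integral_resid_aux (M : Market P N ℱ X α β) (U : RealSpectrum μ u α β) {n : ℕ}
    (hn : n < N) (x : ℝ) :
    chiR P X N μ u (n + 1) x * retVar P X n =
      ∫ ω, etaR P X N μ u (n + 1) (x + incr X (n + 1) ω) * Real.exp (incr X (n + 1) ω) ∂P -
        mgf (incr X (n + 1)) P 1 *
          ∫ ω, etaR P X N μ u (n + 1) (x + incr X (n + 1) ω) ∂P ∧
    etaR P X N μ u n x = ∫ ω, etaR P X N μ u (n + 1) (x + incr X (n + 1) ω) ∂P -
      (mgf (incr X (n + 1)) P 1 - 1) * chiR P X N μ u (n + 1) x := by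
  have h1 := M.chi_mul_retVar U hn x
  have h2 := M.eta_eq U hn x
  simp only [← M.eta_re U hn.le x, ← M.eta_re U hn (x + _), ← M.chi_re U hn x, m_one] at h1 h2
  constructor
  · apply Complex.ofReal_injective
    simpa only [Complex.ofReal_mul, Complex.ofReal_sub, ← integral_complex_ofReal] using h1
  · apply Complex.ofReal_injective
    simpa only [Complex.ofReal_mul, Complex.ofReal_sub, ← integral_complex_ofReal,
      Complex.ofReal_one] using h2

theorem integral_resid (M : Market P N ℱ X α β) (U : RealSpectrum μ u α β) {n : ℕ} (hn : n < N)
    (x : ℝ) : ∫ ω, resid P X N μ u n x (incr X (n + 1) ω) ∂P = 0 := by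
  have i1 := (M.memLp_eta_incr U hn x).integrable one_le_two
  have i2 := ((M.memLp_ret hn).integrable one_le_two).const_mul (chiR P X N μ u (n + 1) x)
  have e : ∫ ω, resid P X N μ u n x (incr X (n + 1) ω) ∂P =
      ∫ ω, (etaR P X N μ u (n + 1) (x + incr X (n + 1) ω) - etaR P X N μ u n x -
        chiR P X N μ u (n + 1) x * ret X n ω) ∂P := rfl
  rw [e, integral_sub (i1.fun_sub (integrable_const _)) i2, integral_sub i1 (integrable_const _),
    integral_const_mul, M.integral_ret hn, (M.integral_resid_aux U hn x).2]
  simp only [integral_const, probReal_univ, one_smul]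
  ring

theorem integral_resid_mul_ret (M : Market P N ℱ X α β) (U : RealSpectrum μ u α β) {n : ℕ}
    (hn : n < N) (x : ℝ) :
    ∫ ω, resid P X N μ u n x (incr X (n + 1) ω) * ret X n ω ∂P = 0 := by
  have L1 := M.memLp_eta_incr U hn x
  have i0 := L1.integrable one_le_two
  have i1 := integrable_mul_of_memLp_two L1 (M.moments_incr hn).memLp_exp
  have i2 := ((M.memLp_ret hn).integrable one_le_two).const_mul (etaR P X N μ u n x)
  have i3 := (M.memLp_ret hn).integrable_sq.const_mul (chiR P X N μ u (n + 1) x)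
  have e : ∀ ω, resid P X N μ u n x (incr X (n + 1) ω) * ret X n ω =
      etaR P X N μ u (n + 1) (x + incr X (n + 1) ω) * Real.exp (incr X (n + 1) ω) -
      etaR P X N μ u (n + 1) (x + incr X (n + 1) ω) -
      etaR P X N μ u n x * ret X n ω - chiR P X N μ u (n + 1) x * ret X n ω ^ 2 :=
    fun ω => by simp only [resid, ret]; ring
  simp only [e]
  obtain ⟨h1, h2⟩ := M.integral_resid_aux U hn x
  rw [integral_sub ((i1.fun_sub i0).fun_sub i2) i3, integral_sub (i1.fun_sub i0) i2,
    integral_sub i1 i0, integral_const_mul, integral_const_mul, M.integral_ret hn,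
    M.integral_ret_sq_eq hn, h2]
  linear_combination -h1

/-- Orthogonality for each frozen x lifts to orthogonality against any Y known at time n, by
freezing the pair (Y, x + X n). The two uses are q = 1 and q(y) = exp y - 1. -/
theorem integral_mul_resid (M : Market P N ℱ X α β) (U : RealSpectrum μ u α β) {n : ℕ}
    (hn : n < N) (x : ℝ) {Y : Ω → ℝ} (hY : Measurable[ℱ n] Y) {q : ℝ → ℝ} (hq : Measurable q)
    (hYq : MemLp (fun ω => Y ω * q (incr X (n + 1) ω)) 2 P)
    (h0 : ∀ x, ∫ ω, resid P X N μ u n x (incr X (n + 1) ω) * q (incr X (n + 1) ω) ∂P = 0) :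
    ∫ ω, Y ω * q (incr X (n + 1) ω) *
      resid P X N μ u n (x + X n ω) (incr X (n + 1) ω) ∂P = 0 := by
  have hYZ : Measurable[ℱ n] fun ω => (Y ω, x + X n ω) :=
    hY.prodMk ((M.adapted n hn.le).const_add x)
  have hr := M.measurable_resid U hn
  have := integral_comp_of_indepFun (hYZ.mono (ℱ.le n) le_rfl) (M.measurable_incr hn)
    (M.indepFun hn hYZ) (G := fun p y => p.1 * q y * resid P X N μ u n p.2 y) ?_
    (integrable_mul_of_memLp_two hYq (M.memLp_resid U hn x))
  · rw [this]
    simp only [mul_assoc, integral_const_mul]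
    simp only [mul_comm (q _), h0, mul_zero, integral_zero]
  · have h1 : Measurable fun p : (ℝ × ℝ) × ℝ => resid P X N μ u n p.1.2 p.2 :=
      hr.comp (f := fun p : (ℝ × ℝ) × ℝ => (p.1.2, p.2)) (by fun_prop)
    unfold Function.uncurry
    fun_prop

end Market

/-! ### The hedging problem -/

section Feedback

variable {Ω : Type*}

/-- The gains of the strategy whose position in period `n + 1` is `F n ω x`, where `x` denotes the
gains up to time `n`. -/
def feedbackGain (S : ℕ → Ω → ℝ) (F : ℕ → Ω → ℝ → ℝ) : ℕ → Ω → ℝ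
  | 0, _ => 0
  | n + 1, ω => feedbackGain S F n ω + F n ω (feedbackGain S F n ω) * incr S (n + 1) ω

/-- The strategy whose position in period `n + 1` is `F n ω x`, where `x` denotes the gains up to
time `n`. -/
def feedback (S : ℕ → Ω → ℝ) (F : ℕ → Ω → ℝ → ℝ) (n : ℕ) (ω : Ω) : ℝ :=
  F (n - 1) ω (feedbackGain S F (n - 1) ω)

theorem gain_zero (S v : ℕ → Ω → ℝ) (ω : Ω) : gain S v 0 ω = 0 := by simp [gain]

theorem gain_succ (S v : ℕ → Ω → ℝ) (n : ℕ) (ω : Ω) :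
    gain S v (n + 1) ω = gain S v n ω + v (n + 1) ω * incr S (n + 1) ω := by
  rw [gain, Finset.sum_Icc_succ_top (by omega)]
  rfl

theorem gain_feedback (S : ℕ → Ω → ℝ) (F : ℕ → Ω → ℝ → ℝ) (n : ℕ) (ω : Ω) :
    gain S (feedback S F) n ω = feedbackGain S F n ω := by
  induction n with
  | zero => rw [gain_zero]; rfl
  | succ n ih => rw [gain_succ, ih]; rfl

theorem feedback_succ (S : ℕ → Ω → ℝ) (F : ℕ → Ω → ℝ → ℝ) (n : ℕ) (ω : Ω) :
    feedback S F (n + 1) ω = F n ω (gain S (feedback S F) n ω) := by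
  rw [gain_feedback]; rfl

end Feedback

/-! ### Prices and returns -/

section Price

variable {Ω : Type*}

theorem price_eq_exp {s₀ : ℝ} (hs₀ : 0 < s₀) (X : ℕ → Ω → ℝ) (n : ℕ) (ω : Ω) :
    price s₀ X n ω = Real.exp (Real.log s₀ + X n ω) := by
  rw [price, Real.exp_add, Real.exp_log hs₀]

theorem price_pos {s₀ : ℝ} (hs₀ : 0 < s₀) (X : ℕ → Ω → ℝ) (n : ℕ) (ω : Ω) :
    0 < price s₀ X n ω :=
  mul_pos hs₀ (Real.exp_pos _)

theorem incr_price (s₀ : ℝ) (X : ℕ → Ω → ℝ) (n : ℕ) (ω : Ω) :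
    incr (price s₀ X) (n + 1) ω = price s₀ X n ω * ret X n ω := by
  simp only [incr, price, ret, Nat.add_sub_cancel]
  rw [Real.exp_sub]
  field_simp

end Price

/-! ### The error recursion and admissible gains -/

section MinErr

variable {Ω : Type*} {mΩ : MeasurableSpace Ω}

/-- The factor `a(n + 1)` as a real number. -/
noncomputable def riskFactor (P : Measure Ω) (X : ℕ → Ω → ℝ) (n : ℕ) : ℝ :=
  1 - (∫ ω, ret X n ω ∂P) ^ 2 / ∫ ω, ret X n ω ^ 2 ∂P

/-- The second moment of the residual in period `n + 1`. -/
noncomputable def residSq (P : Measure Ω) (X : ℕ → Ω → ℝ) (N : ℕ) (μ : Measure ℂ) (u : ℂ → ℂ)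
    (x₀ : ℝ) (n : ℕ) : ℝ :=
  ∫ ω, resid P X N μ u n (x₀ + X n ω) (incr X (n + 1) ω) ^ 2 ∂P

/-- The minimal error, defined recursively. -/
noncomputable def minErr (P : Measure Ω) (X : ℕ → Ω → ℝ) (N : ℕ) (μ : Measure ℂ) (u : ℂ → ℂ)
    (x₀ : ℝ) : ℕ → ℝ
  | 0 => 0
  | n + 1 => residSq P X N μ u x₀ n + riskFactor P X n * minErr P X N μ u x₀ n

theorem minErr_eq_sum (P : Measure Ω) (X : ℕ → Ω → ℝ) (N : ℕ) (μ : Measure ℂ) (u : ℂ → ℂ)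
    (x₀ : ℝ) (n : ℕ) : minErr P X N μ u x₀ n = ∑ k ∈ Finset.Icc 1 n,
      residSq P X N μ u x₀ (k - 1) * ∏ j ∈ Finset.Icc (k + 1) n, riskFactor P X (j - 1) := by
  induction n with
  | zero => simp [minErr]
  | succ n ih =>
    rw [Finset.sum_Icc_succ_top (by omega), minErr, ih, Finset.mul_sum, add_comm]
    congr 1
    · refine Finset.sum_congr rfl fun k hk => ?_
      rw [Finset.prod_Icc_succ_top (by simp at hk; omega), Nat.add_sub_cancel]
      ring
    · simp

/-- The difference between the value process and the wealth of a strategy. -/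
noncomputable def gap (P : Measure Ω) (X : ℕ → Ω → ℝ) (N : ℕ) (μ : Measure ℂ) (u : ℂ → ℂ)
    (s₀ V : ℝ) (v : ℕ → Ω → ℝ) (n : ℕ) (ω : Ω) : ℝ :=
  etaR P X N μ u n (Real.log s₀ + X n ω) - V - gain (price s₀ X) v n ω

theorem Theta_succ_subset (P : Measure Ω) (ℱ : Filtration ℕ mΩ) (S : ℕ → Ω → ℝ) (n : ℕ) :
    Theta P ℱ S (n + 1) ⊆ Theta P ℱ S n := fun _ hv k hk =>
  hv k (Finset.Icc_subset_Icc_right n.le_succ hk)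

theorem mem_Theta_succ {P : Measure Ω} {ℱ : Filtration ℕ mΩ} {S v : ℕ → Ω → ℝ} {n : ℕ}
    (h : v ∈ Theta P ℱ S n) (h1 : Measurable[ℱ n] (v (n + 1)))
    (h2 : MemLp (fun ω => v (n + 1) ω * incr S (n + 1) ω) 2 P) : v ∈ Theta P ℱ S (n + 1) := by
  intro k hk
  rcases Nat.lt_or_ge n k with h' | h'
  · obtain rfl : k = n + 1 := by simp at hk; omega
    exact ⟨h1, h2⟩
  · exact h k (by simp at hk ⊢; omega)

theorem memLp_gain {P : Measure Ω} {ℱ : Filtration ℕ mΩ} {S v : ℕ → Ω → ℝ} {n : ℕ}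
    (hv : v ∈ Theta P ℱ S n) : MemLp (gain S v n) 2 P :=
  memLp_finsetSum _ fun k hk => (hv k hk).2

end MinErr

/-! ### Lower bound for the error, and the strategy attaining it -/

namespace Market

variable {Ω : Type*} {mΩ : MeasurableSpace Ω} {P : Measure Ω} [IsProbabilityMeasure P] {N : ℕ}
  {ℱ : Filtration ℕ mΩ} {X : ℕ → Ω → ℝ} {α β : ℝ} {μ : Measure ℂ} [IsFiniteMeasure μ] {u : ℂ → ℂ}
  {s₀ : ℝ} {v : ℕ → Ω → ℝ}

omit [IsProbabilityMeasure P] in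
theorem measurable_price (M : Market P N ℱ X α β) {n : ℕ} (hn : n ≤ N) :
    Measurable[ℱ n] (price s₀ X n) :=
  (Real.measurable_exp.comp (M.adapted n hn)).const_mul s₀

omit [IsProbabilityMeasure P] in
theorem measurable_gain (M : Market P N ℱ X α β) {n : ℕ} (hn : n ≤ N)
    (hv : v ∈ Theta P ℱ (price s₀ X) n) : Measurable[ℱ n] (gain (price s₀ X) v n) := by
  refine Finset.measurable_fun_sum _ fun k hk => ?_
  have hk' := Finset.mem_Icc.1 hk
  refine ((hv k hk).1.mono (ℱ.mono (by omega)) le_rfl).mul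
    (Measurable.sub ((M.measurable_price (by omega)).mono (ℱ.mono hk'.2) le_rfl)
      ((M.measurable_price (by omega)).mono (ℱ.mono (by omega)) le_rfl))

theorem measurable_gap (M : Market P N ℱ X α β) (U : RealSpectrum μ u α β) {n : ℕ} (hn : n ≤ N)
    (hv : v ∈ Theta P ℱ (price s₀ X) n) (V : ℝ) : Measurable[ℱ n] (gap P X N μ u s₀ V v n) :=
  (((M.measurable_eta U n).comp ((M.adapted n hn).const_add _)).sub_const V).sub
    (M.measurable_gain hn hv)

theorem memLp_gap (M : Market P N ℱ X α β) (U : RealSpectrum μ u α β) {n : ℕ} (hn : n ≤ N)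
    (hv : v ∈ Theta P ℱ (price s₀ X) n) (V : ℝ) : MemLp (gap P X N μ u s₀ V v n) 2 P :=
  ((M.memLp_eta U hn _).fun_sub (memLp_const V)).fun_sub (memLp_gain hv)

omit [IsProbabilityMeasure P] [IsFiniteMeasure μ] in
-- Puts one step into the form D + W R + L, where W is the mismatch between χ and the amount of
-- money invested.
theorem gap_succ (V : ℝ) (n : ℕ) (ω : Ω) :
    gap P X N μ u s₀ V v (n + 1) ω = gap P X N μ u s₀ V v n ω +
      (chiR P X N μ u (n + 1) (Real.log s₀ + X n ω) - v (n + 1) ω * price s₀ X n ω) * ret X n ω +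
      resid P X N μ u n (Real.log s₀ + X n ω) (incr X (n + 1) ω) := by
  simp only [gap, gain_succ, incr_price, resid, X_succ X n, ret, ← add_assoc]
  ring

theorem integral_gap_sq_succ (M : Market P N ℱ X α β) (U : RealSpectrum μ u α β) {n : ℕ}
    (hn : n < N) (hv : v ∈ Theta P ℱ (price s₀ X) (n + 1)) (V : ℝ) :
    ∫ ω, gap P X N μ u s₀ V v (n + 1) ω ^ 2 ∂P =
      residSq P X N μ u (Real.log s₀) n +
        riskFactor P X n * ∫ ω, gap P X N μ u s₀ V v n ω ^ 2 ∂P +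
        (∫ ω, ret X n ω ^ 2 ∂P) *
          ∫ ω, (chiR P X N μ u (n + 1) (Real.log s₀ + X n ω) - v (n + 1) ω * price s₀ X n ω +
            (∫ ω, ret X n ω ∂P) / (∫ ω, ret X n ω ^ 2 ∂P) * gap P X N μ u s₀ V v n ω) ^ 2 ∂P := by
  have hv' := Theta_succ_subset _ _ _ _ hv
  have hvn := hv (n + 1) (by simp)
  have hD := M.measurable_gap U hn.le hv' V
  have hDL := M.memLp_gap U hn.le hv' V
  have hW : Measurable[ℱ n] fun ω =>
      chiR P X N μ u (n + 1) (Real.log s₀ + X n ω) - v (n + 1) ω * price s₀ X n ω :=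
    ((M.measurable_chi U hn).comp ((M.adapted n hn.le).const_add _)).sub
      (hvn.1.mul (M.measurable_price hn.le))
  have hWR : MemLp (fun ω => (chiR P X N μ u (n + 1) (Real.log s₀ + X n ω) -
      v (n + 1) ω * price s₀ X n ω) * ret X n ω) 2 P := by
    have := (M.memLp_chi_mul_ret U hn (Real.log s₀)).fun_sub hvn.2
    simp only [incr_price] at this
    simpa only [sub_mul, mul_assoc] using this
  have hq : Measurable fun y : ℝ => Real.exp y - 1 := by fun_prop
  simp only [gap_succ]
  refine integral_sq_one_period hDL (hW.mono (ℱ.le n) le_rfl) (M.memLp_ret hn) hWR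
    (M.memLp_resid U hn _) ?_ ?_ ?_ (M.integral_ret_sq_pos hn)
  · exact (M.indepFun hn (hD.prodMk hW)).comp (φ := id) measurable_id hq
  · simpa using M.integral_mul_resid U hn (Real.log s₀) hD (q := fun _ => 1) measurable_const
      (by simpa using hDL) (fun x => by simpa using M.integral_resid U hn x)
  · exact M.integral_mul_resid U hn (Real.log s₀) hW hq hWR (M.integral_resid_mul_ret U hn)

/-- The squared mean of the return is at most its second moment. The sign lets the lower bound pass
through the recursion. -/
theorem riskFactor_nonneg (M : Market P N ℱ X α β) {n : ℕ} (hn : n < N) :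
    0 ≤ riskFactor P X n := by
  have h1 := M.integral_ret_sq_pos hn
  rw [riskFactor, sub_nonneg, div_le_one h1, M.integral_ret_sq_eq hn, M.integral_ret hn]
  linarith [M.retVar_pos hn]

/-- Forward induction on the recursion for E D², discarding D_0² and each completed square. -/
theorem minErr_le (M : Market P N ℱ X α β) (U : RealSpectrum μ u α β) {n : ℕ} (hn : n ≤ N)
    (hv : v ∈ Theta P ℱ (price s₀ X) n) (V : ℝ) :
    minErr P X N μ u (Real.log s₀) n ≤ ∫ ω, gap P X N μ u s₀ V v n ω ^ 2 ∂P := by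
  induction n with
  | zero => exact integral_nonneg fun ω => sq_nonneg _
  | succ n ih =>
    have hn' : n < N := hn
    have h0 := ih hn'.le (Theta_succ_subset _ _ _ _ hv)
    rw [M.integral_gap_sq_succ U hn' hv, minErr]
    have h1 := mul_le_mul_of_nonneg_left h0 (M.riskFactor_nonneg hn')
    have h2 : 0 ≤ (∫ ω, ret X n ω ^ 2 ∂P) *
        ∫ ω, (chiR P X N μ u (n + 1) (Real.log s₀ + X n ω) - v (n + 1) ω * price s₀ X n ω +
          (∫ ω, ret X n ω ∂P) / (∫ ω, ret X n ω ^ 2 ∂P) * gap P X N μ u s₀ V v n ω) ^ 2 ∂P :=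
      mul_nonneg (M.integral_ret_sq_pos hn').le (integral_nonneg fun ω => sq_nonneg _)
    linarith

/-- Nothing is lost in the lower bound: the choice of V makes D_0 = 0, and the feedback equation
makes every completed square zero. -/
theorem integral_gap_sq_eq_minErr (M : Market P N ℱ X α β) (U : RealSpectrum μ u α β) {n : ℕ}
    (hn : n ≤ N) (hv : v ∈ Theta P ℱ (price s₀ X) n) {V : ℝ}
    (hV : V = etaR P X N μ u 0 (Real.log s₀))
    (hopt : ∀ k < n, ∀ ω, v (k + 1) ω * price s₀ X k ω =
      chiR P X N μ u (k + 1) (Real.log s₀ + X k ω) +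
        (∫ ω, ret X k ω ∂P) / (∫ ω, ret X k ω ^ 2 ∂P) * gap P X N μ u s₀ V v k ω) :
    ∫ ω, gap P X N μ u s₀ V v n ω ^ 2 ∂P = minErr P X N μ u (Real.log s₀) n := by
  induction n with
  | zero => simp [gap, gain_zero, M.zero, hV, minErr]
  | succ n ih =>
    have hn' : n < N := hn
    rw [M.integral_gap_sq_succ U hn' hv, minErr,
      ih hn'.le (Theta_succ_subset _ _ _ _ hv) fun k hk => hopt k (by omega)]
    simp [hopt n (by omega)]

/-- The optimal position in period `n + 1`, as a function of the gains `x` up to time `n`. -/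
noncomputable def _root_.DiscreteHedging.optimalPosition (P : Measure Ω) (X : ℕ → Ω → ℝ) (N : ℕ)
    (μ : Measure ℂ) (u : ℂ → ℂ) (s₀ : ℝ) (n : ℕ) (ω : Ω) (x : ℝ) : ℝ :=
  (chiR P X N μ u (n + 1) (Real.log s₀ + X n ω) +
    (∫ ω, ret X n ω ∂P) / (∫ ω, ret X n ω ^ 2 ∂P) *
      (etaR P X N μ u n (Real.log s₀ + X n ω) - etaR P X N μ u 0 (Real.log s₀) - x)) /
    price s₀ X n ω

/-- The optimal strategy. -/
noncomputable def _root_.DiscreteHedging.optimalStrategy (P : Measure Ω) (X : ℕ → Ω → ℝ) (N : ℕ)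
    (μ : Measure ℂ) (u : ℂ → ℂ) (s₀ : ℝ) : ℕ → Ω → ℝ :=
  feedback (price s₀ X) (optimalPosition P X N μ u s₀)

omit [IsProbabilityMeasure P] [IsFiniteMeasure μ] in
theorem optimalStrategy_mul_price (hs₀ : 0 < s₀) (n : ℕ) (ω : Ω) :
    optimalStrategy P X N μ u s₀ (n + 1) ω * price s₀ X n ω =
      chiR P X N μ u (n + 1) (Real.log s₀ + X n ω) +
        (∫ ω, ret X n ω ∂P) / (∫ ω, ret X n ω ^ 2 ∂P) *
          gap P X N μ u s₀ (etaR P X N μ u 0 (Real.log s₀)) (optimalStrategy P X N μ u s₀) n ω := by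
  rw [optimalStrategy, feedback_succ, optimalPosition, div_mul_cancel₀ _ (price_pos hs₀ X n ω).ne']
  rfl

/-- The position in period n + 1 depends on the gap at time n, which by induction is measurable and
square integrable; multiplying by the independent return preserves square integrability. -/
theorem optimalStrategy_mem (M : Market P N ℱ X α β) (U : RealSpectrum μ u α β) (hs₀ : 0 < s₀)
    {n : ℕ} (hn : n ≤ N) : optimalStrategy P X N μ u s₀ ∈ Theta P ℱ (price s₀ X) n := by
  induction n with
  | zero => intro k hk; simp at hk
  | succ n ih =>
    have hn' : n < N := hn
    have h := ih hn'.le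
    have hD := M.measurable_gap U hn'.le h (etaR P X N μ u 0 (Real.log s₀))
    have hDL := M.memLp_gap U hn'.le h (etaR P X N μ u 0 (Real.log s₀))
    refine mem_Theta_succ h ?_ ?_
    · have e : optimalStrategy P X N μ u s₀ (n + 1) = fun ω =>
          (chiR P X N μ u (n + 1) (Real.log s₀ + X n ω) +
          (∫ ω, ret X n ω ∂P) / (∫ ω, ret X n ω ^ 2 ∂P) *
          gap P X N μ u s₀ (etaR P X N μ u 0 (Real.log s₀)) (optimalStrategy P X N μ u s₀) n ω) /
            price s₀ X n ω := by
        funext ω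
        rw [← optimalStrategy_mul_price hs₀, mul_div_cancel_right₀ _ (price_pos hs₀ X n ω).ne']
      rw [e]
      exact (((M.measurable_chi U hn').comp ((M.adapted n hn'.le).const_add _)).add
        (hD.const_mul _)).div (M.measurable_price hn'.le)
    · simp only [incr_price, ← mul_assoc, optimalStrategy_mul_price hs₀, add_mul]
      refine (M.memLp_chi_mul_ret U hn' _).add ?_
      simp only [mul_assoc]
      refine MemLp.const_mul (memLp_two_mul_of_indepFun ?_ hDL (M.memLp_ret hn')) _
      exact (M.indepFun hn' hD).comp (φ := id) (ψ := fun y => Real.exp y - 1) measurable_id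
        (by fun_prop)

end Market

/-! ### The double integral for the minimal error -/

section Kernel

variable {Ω : Type*} {mΩ : MeasurableSpace Ω}

/-- The contribution of `z` to the residual in period `n + 1`. -/
noncomputable def residKernel (P : Measure Ω) (X : ℕ → Ω → ℝ) (N : ℕ) (x₀ : ℝ) (n : ℕ) (z : ℂ)
    (ω : Ω) : ℂ :=
  h P X N z (n + 1) * Complex.exp (z * (x₀ + X n ω : ℝ)) *
    expResid P (incr X (n + 1)) z (incr X (n + 1) ω)

theorem rho_succ (P : Measure Ω) (X : ℕ → Ω → ℝ) (y z : ℂ) (n : ℕ) :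
    rho P X y z (n + 1) = expCov P (incr X (n + 1)) y z := by
  simp only [rho, m_succ, expCov]

theorem g_succ (P : Measure Ω) (X : ℕ → Ω → ℝ) (z : ℂ) (n : ℕ) :
    g P X z (n + 1) =
      expCov P (incr X (n + 1)) z 1 / expCov P (incr X (n + 1)) 1 1 := by
  simp only [g, m_succ, expCov, one_add_one_eq_two]
  ring

theorem prod_Icc_two_pred (f : ℕ → ℂ) (n : ℕ) :
    ∏ l ∈ Finset.Icc 2 (n + 1), f (l - 1) = ∏ l ∈ Finset.Icc 1 n, f l := by
  induction n with
  | zero => simp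
  | succ n ih =>
    rw [Finset.prod_Icc_succ_top (by omega), ih, Finset.prod_Icc_succ_top (by omega)]
    rfl

end Kernel

namespace Market

variable {Ω : Type*} {mΩ : MeasurableSpace Ω} {P : Measure Ω} [IsProbabilityMeasure P] {N : ℕ}
  {ℱ : Filtration ℕ mΩ} {X : ℕ → Ω → ℝ} {α β : ℝ} {μ : Measure ℂ} [IsFiniteMeasure μ] {u : ℂ → ℂ}

/-- The one-step recursion for h recombines the three integrands so that each z contributes exactly
the regression residual of exp(zΔX) on exp(ΔX). -/
theorem resid_eq_integral (M : Market P N ℱ X α β) (U : RealSpectrum μ u α β) {n : ℕ} (hn : n < N)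
    (x y : ℝ) : (resid P X N μ u n x y : ℂ) =
      ∫ z, h P X N z (n + 1) * Complex.exp (z * x) * expResid P (incr X (n + 1)) z y * u z ∂μ := by
  have i1 := integrable_lap U.ae_mem (M.bddOn_h_mul U (n + 1)) (x + y)
  have i2 := integrable_lap U.ae_mem (M.bddOn_h_mul U n) x
  have i3 := (integrable_lap U.ae_mem (M.bddOn_g_mul U hn) x).mul_const (Complex.exp y - 1)
  have e : ∀ z, h P X N z (n + 1) * Complex.exp (z * x) * expResid P (incr X (n + 1)) z y * u z =
      h P X N z (n + 1) * u z * Complex.exp (z * (x + y : ℝ)) -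
      h P X N z n * u z * Complex.exp (z * x) -
      g P X z (n + 1) * (h P X N z (n + 1) * u z) * Complex.exp (z * x) * (Complex.exp y - 1) := by
    intro z
    rw [h_eq_mul_succ z hn, expResid, ← g_succ, ← m_succ, ← m_succ, Complex.ofReal_add, mul_add,
      Complex.exp_add, one_mul]
    ring
  simp only [e]
  rw [integral_sub (i1.fun_sub i2) i3, integral_sub i1 i2, integral_mul_const]
  simp only [resid, Complex.ofReal_sub, Complex.ofReal_mul, Complex.ofReal_exp, Complex.ofReal_one]
  rw [M.eta_re U hn, M.eta_re U hn.le, M.chi_re U hn]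
  rfl

theorem measurable_residKernel (M : Market P N ℱ X α β) (x₀ : ℝ) {n : ℕ} (hn : n < N) :
    Measurable (Function.uncurry (residKernel P X N x₀ n)) := by
  have h1 := (M.bddOn_h (n + 1)).measurable
  have h2 := (M.bddOn_m hn).measurable
  have h3 := (M.bddOn_g hn).measurable
  have h4 := M.measurable_X hn.le
  have h5 := M.measurable_incr hn
  simp only [Function.uncurry_def, residKernel, expResid, ← g_succ, ← m_succ]
  have h2' : Measurable fun p : ℂ × Ω => m P X p.1 (n + 1) := h2.comp measurable_fst
  have h1' : Measurable fun p : ℂ × Ω => h P X N p.1 (n + 1) := h1.comp measurable_fst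
  have h3' : Measurable fun p : ℂ × Ω => g P X p.1 (n + 1) := h3.comp measurable_fst
  fun_prop

/-- A square integrable bound uniform over the strip. Its square dominates the product of two
kernels, which yields both the Fubini interchange and the integrability of J₀. -/
theorem exists_residKernel_bound (M : Market P N ℱ X α β) (x₀ : ℝ) {n : ℕ} (hn : n < N) :
    ∃ W : Ω → ℝ, MemLp W 2 P ∧ ∀ z ∈ strip α β, ∀ ω, ‖residKernel P X N x₀ n z ω‖ ≤ W ω := by
  obtain ⟨-, C₁, hC₁, h1⟩ := M.bddOn_h (n + 1)
  obtain ⟨-, C₂, hC₂, h2⟩ := M.bddOn_m hn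
  obtain ⟨-, C₃, hC₃, h3⟩ := M.bddOn_g hn
  set q : ℝ → ℝ := fun y => expEnv α β y + C₂ + C₃ * (Real.exp y + ‖m P X 1 (n + 1)‖) with hq
  have hqm : Measurable q := by fun_prop
  have hqL : MemLp (fun ω => q (incr X (n + 1) ω)) 2 P :=
    ((M.moments_incr hn).memLp_expEnv.add (memLp_const C₂)).add
      (((M.moments_incr hn).memLp_exp.add (memLp_const _)).const_mul C₃)
  have hi := (M.indepFun hn (M.adapted n hn.le)).comp (measurable_expEnv α β) hqm
  refine ⟨fun ω => C₁ * expEnv α β x₀ * (expEnv α β (X n ω) * q (incr X (n + 1) ω)),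
    (memLp_two_mul_of_indepFun hi (M.moments_X hn.le).memLp_expEnv hqL).const_mul _,
    fun z hz ω => ?_⟩
  have hE := (norm_cexp_mul_le_expEnv hz (x₀ + X n ω)).trans (expEnv_add_le _ _ _ _)
  have hR : ‖expResid P (incr X (n + 1)) z (incr X (n + 1) ω)‖ ≤ q (incr X (n + 1) ω) := by
    rw [expResid, ← g_succ, ← m_succ, ← m_succ, one_mul, ← Complex.ofReal_exp]
    refine (norm_sub_le _ _).trans (add_le_add ((norm_sub_le _ _).trans
      (add_le_add (norm_cexp_mul_le_expEnv hz _) (h2 z hz))) ?_)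
    rw [norm_mul]
    refine mul_le_mul (h3 z hz) ((norm_sub_le _ _).trans (add_le_add (le_of_eq ?_) le_rfl))
      (norm_nonneg _) hC₃
    rw [Complex.norm_real, Real.norm_eq_abs, Real.abs_exp]
  rw [residKernel, norm_mul, norm_mul]
  have p1 := (expEnv_pos α β x₀).le
  have p2 := (expEnv_pos α β (X n ω)).le
  calc _ ≤ C₁ * (expEnv α β x₀ * expEnv α β (X n ω)) * q (incr X (n + 1) ω) := by
        refine mul_le_mul (mul_le_mul (h1 z hz) hE (norm_nonneg _) hC₁) hR (norm_nonneg _)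
          (by positivity)
    _ = _ := by ring

theorem integrable_residKernel_mul (M : Market P N ℱ X α β) (hμ : ∀ᵐ z ∂μ, z ∈ strip α β)
    (x₀ : ℝ) {n : ℕ} (hn : n < N) :
    Integrable (fun q : (ℂ × ℂ) × Ω => residKernel P X N x₀ n q.1.1 q.2 *
      residKernel P X N x₀ n q.1.2 q.2) ((μ.prod μ).prod P) := by
  obtain ⟨W, hW, hb⟩ := M.exists_residKernel_bound x₀ hn
  have hm := M.measurable_residKernel x₀ hn
  have hm1 : Measurable fun q : (ℂ × ℂ) × Ω => residKernel P X N x₀ n q.1.1 q.2 :=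
    hm.comp (f := fun q : (ℂ × ℂ) × Ω => (q.1.1, q.2)) (by fun_prop)
  have hm2 : Measurable fun q : (ℂ × ℂ) × Ω => residKernel P X N x₀ n q.1.2 q.2 :=
    hm.comp (f := fun q : (ℂ × ℂ) × Ω => (q.1.2, q.2)) (by fun_prop)
  refine Integrable.mono' (g := fun q => W q.2 * W q.2)
    ((integrable_mul_of_memLp_two hW hW).comp_snd _) (hm1.mul hm2).aestronglyMeasurable ?_
  filter_upwards [Measure.quasiMeasurePreserving_fst.ae
      (Measure.quasiMeasurePreserving_fst.ae hμ),
    Measure.quasiMeasurePreserving_fst.ae (Measure.quasiMeasurePreserving_snd.ae hμ)] with q h1 h2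
  rw [norm_mul]
  exact mul_le_mul (hb _ h1 _) (hb _ h2 _) (norm_nonneg _) ((norm_nonneg _).trans (hb _ h1 _))

/-- The residual is real, so its square is the plain product of its integral representation with
itself, a double integral without conjugates; Fubini then moves the expectation inside. -/
theorem residSq_eq_integral (M : Market P N ℱ X α β) (U : RealSpectrum μ u α β) (x₀ : ℝ) {n : ℕ}
    (hn : n < N) : (residSq P X N μ u x₀ n : ℂ) =
      ∫ p, (∫ ω, residKernel P X N x₀ n p.1 ω * residKernel P X N x₀ n p.2 ω ∂P) *
        (u p.1 * u p.2) ∂μ.prod μ := by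
  have hu := U.measurable
  have hint : Integrable (Function.uncurry fun (p : ℂ × ℂ) (ω : Ω) =>
      residKernel P X N x₀ n p.1 ω * residKernel P X N x₀ n p.2 ω * (u p.1 * u p.2))
      ((μ.prod μ).prod P) :=
    (M.integrable_residKernel_mul U.ae_mem x₀ hn).mul_bdd (c := 1)
      (Measurable.aestronglyMeasurable (by fun_prop))
      (ae_of_all _ fun q => by simp [U.norm_eq_one])
  simp only [← integral_mul_const]
  rw [integral_integral_swap hint, residSq, ← integral_complex_ofReal]
  refine integral_congr_ae (ae_of_all _ fun ω => ?_)
  simp only [Complex.ofReal_pow]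
  rw [M.resid_eq_integral U hn, sq, ← integral_prod_mul]
  refine integral_congr_ae (ae_of_all _ fun p => ?_)
  simp only [residKernel]
  ring

/-- The factor S_n^{y+z} depends on the past and the two regression residuals on the next increment.
Independence splits the expectation into the power moment, giving s₀^{y+z} and the product of the m,
and the residual covariance, giving b. -/
theorem integral_residKernel_mul (M : Market P N ℱ X α β) {s₀ : ℝ} (hs₀ : 0 < s₀) {n : ℕ}
    (hn : n < N) {y z : ℂ} (hy : y ∈ strip α β) (hz : z ∈ strip α β) :
    ∫ ω, residKernel P X N (Real.log s₀) n y ω * residKernel P X N (Real.log s₀) n z ω ∂P =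
      (s₀ : ℂ) ^ (y + z) * (b P X y z (n + 1) * h P X N z (n + 1) * h P X N y (n + 1) *
        ∏ l ∈ Finset.Icc 2 (n + 1), m P X (y + z) (l - 1)) := by
  have hM := M.moments_incr hn
  have h0 : expCov P (incr X (n + 1)) 1 1 ≠ 0 := by
    rw [expCov_one_one]; exact_mod_cast (M.retVar_pos hn).ne'
  have hX := M.measurable_X hn.le
  have hξ := M.measurable_incr hn
  have hE := integral_expResid_mul_expResid (hM.memLp_cexp hy) (hM.memLp_cexp hz)
    hM.memLp_cexp_one h0
  have hm1 : ∀ w, Measurable fun x : ℝ => expResid P (incr X (n + 1)) w x := fun w => by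
    unfold expResid; fun_prop
  have hind := ((M.indepFun hn (M.adapted n hn.le)).comp
    (φ := fun x : ℝ => Complex.exp ((y + z) * x))
    (ψ := fun x : ℝ => expResid P (incr X (n + 1)) y x * expResid P (incr X (n + 1)) z x)
    (by fun_prop) ((hm1 y).mul (hm1 z))).integral_fun_mul_eq_mul_integral
    (Measurable.aestronglyMeasurable (by fun_prop))
    ((((hm1 y).mul (hm1 z)).comp hξ).aestronglyMeasurable)
  simp only [Function.comp_def] at hind
  have hpow : (s₀ : ℂ) ^ (y + z) = Complex.exp ((y + z) * Real.log s₀) := by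
    rw [Complex.cpow_def_of_ne_zero (by exact_mod_cast hs₀.ne'), ← Complex.ofReal_log hs₀.le,
      mul_comm]
  have e : ∀ ω, residKernel P X N (Real.log s₀) n y ω * residKernel P X N (Real.log s₀) n z ω =
      h P X N z (n + 1) * h P X N y (n + 1) * (s₀ : ℂ) ^ (y + z) *
      (Complex.exp ((y + z) * X n ω) * (expResid P (incr X (n + 1)) y (incr X (n + 1) ω) *
        expResid P (incr X (n + 1)) z (incr X (n + 1) ω))) := fun ω => by
    rw [hpow]
    simp only [residKernel, Complex.ofReal_add, mul_add, add_mul, Complex.exp_add]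
    ring
  simp only [e]
  rw [integral_const_mul, hind, hE, prod_Icc_two_pred, ← M.complexMGF_X _ hn.le, b, rho_succ,
    rho_succ, rho_succ, rho_succ, complexMGF]
  ring

/-- With B the second moment of the return and A its mean, 1 - A²/B = (B - A²)/B, and the return has
the same variance as the price ratio. -/
theorem a_succ (M : Market P N ℱ X α β) {n : ℕ} (hn : n < N) :
    a P X (n + 1) = (riskFactor P X n : ℝ) := by
  have hB := M.integral_ret_sq_pos hn
  have e : riskFactor P X n = (mgf (incr X (n + 1)) P 2 - mgf (incr X (n + 1)) P 1 ^ 2) /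
      (mgf (incr X (n + 1)) P 2 - 2 * mgf (incr X (n + 1)) P 1 + 1) := by
    rw [riskFactor, M.integral_ret hn]
    rw [M.integral_ret_sq hn] at hB ⊢
    rw [eq_div_iff hB.ne', sub_mul, div_mul_cancel₀ _ hB.ne']
    ring
  rw [a, m_one, m_two, e]
  push_cast
  rfl

end Market

/-! ### The minimal error as an integral against Π ⊗ Π -/

section FinalError

variable {Ω : Type*} {mΩ : MeasurableSpace Ω} {P : Measure Ω} [IsProbabilityMeasure P] {N : ℕ}
  {ℱ : Filtration ℕ mΩ} {X : ℕ → Ω → ℝ} {α β : ℝ} {Pi : ComplexMeasure ℂ} {s₀ : ℝ}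

/-- Makes the cut-off of J₀ outside the support invisible to the integrals. -/
theorem supp_mem_ae (Pi : ComplexMeasure ℂ) : ∀ᵐ z ∂Pi.variation, z ∈ supp Pi :=
  Measure.support_mem_ae

theorem Market.J₀_eq (M : Market P N ℱ X α β) (hs₀ : 0 < s₀) (hsupp : supp Pi ⊆ strip α β) {y z : ℂ}
    (hy : y ∈ supp Pi) (hz : z ∈ supp Pi) :
    J₀ P X N s₀ Pi y z = ∑ k ∈ Finset.Icc 1 N,
      ((∏ j ∈ Finset.Icc (k + 1) N, riskFactor P X (j - 1) : ℝ) : ℂ) *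
        ∫ ω, residKernel P X N (Real.log s₀) (k - 1) y ω *
          residKernel P X N (Real.log s₀) (k - 1) z ω ∂P := by
  rw [J₀, if_pos ⟨hy, hz⟩, Finset.mul_sum]
  refine Finset.sum_congr rfl fun k hk => ?_
  obtain ⟨n, rfl⟩ : ∃ n, k = n + 1 := ⟨k - 1, by simp at hk; omega⟩
  have hn : n < N := by simp at hk; omega
  have hprod : ∏ j ∈ Finset.Icc (n + 1 + 1) N, a P X j =
      ((∏ j ∈ Finset.Icc (n + 1 + 1) N, riskFactor P X (j - 1) : ℝ) : ℂ) := by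
    rw [Complex.ofReal_prod]
    refine Finset.prod_congr rfl fun j hj => ?_
    obtain ⟨i, rfl⟩ : ∃ i, j = i + 1 := ⟨j - 1, by simp at hj; omega⟩
    exact M.a_succ (by simp at hj; omega)
  rw [Nat.add_sub_cancel, M.integral_residKernel_mul hs₀ hn (hsupp hy) (hsupp hz), hprod]
  ring

theorem Market.J₀_ae_eq (M : Market P N ℱ X α β) (hs₀ : 0 < s₀) (hsupp : supp Pi ⊆ strip α β)
    [IsFiniteMeasure Pi.variation] :
    (fun p : ℂ × ℂ => J₀ P X N s₀ Pi p.1 p.2) =ᵐ[Pi.variation.prod Pi.variation]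
      fun p => ∑ k ∈ Finset.Icc 1 N,
      ((∏ j ∈ Finset.Icc (k + 1) N, riskFactor P X (j - 1) : ℝ) : ℂ) *
        ∫ ω, residKernel P X N (Real.log s₀) (k - 1) p.1 ω *
          residKernel P X N (Real.log s₀) (k - 1) p.2 ω ∂P := by
  filter_upwards [Measure.quasiMeasurePreserving_fst.ae (supp_mem_ae Pi),
    Measure.quasiMeasurePreserving_snd.ae (supp_mem_ae Pi)] with p h1 h2
  exact M.J₀_eq hs₀ hsupp h1 h2

theorem Market.integrable_integral_residKernel_mul (M : Market P N ℱ X α β) {μ : Measure ℂ}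
    [IsFiniteMeasure μ] (hμ : ∀ᵐ z ∂μ, z ∈ strip α β) (x₀ : ℝ) {k : ℕ} (hk : k ∈ Finset.Icc 1 N) :
    Integrable (fun p : ℂ × ℂ => ∫ ω, residKernel P X N x₀ (k - 1) p.1 ω *
      residKernel P X N x₀ (k - 1) p.2 ω ∂P) (μ.prod μ) :=
  (M.integrable_residKernel_mul hμ x₀ (by simp at hk; omega)).integral_prod_left

theorem Market.integrable_J₀ (M : Market P N ℱ X α β) (hs₀ : 0 < s₀) (hsupp : supp Pi ⊆ strip α β)
    [IsFiniteMeasure Pi.variation] :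
    Integrable (fun p : ℂ × ℂ => J₀ P X N s₀ Pi p.1 p.2) (Pi.variation.prod Pi.variation) := by
  refine Integrable.congr ?_ (M.J₀_ae_eq hs₀ hsupp).symm
  exact integrable_finsetSum _ fun k hk => (M.integrable_integral_residKernel_mul
    ((supp_mem_ae Pi).mono fun z hz => hsupp hz) _ hk).const_mul _

theorem Market.minErr_eq_integral (M : Market P N ℱ X α β) (hs₀ : 0 < s₀)
    (hsupp : supp Pi ⊆ strip α β) [IsFiniteMeasure Pi.variation] {u : ℂ → ℂ}
    (U : RealSpectrum Pi.variation u α β) :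
    (minErr P X N Pi.variation u (Real.log s₀) N : ℂ) =
      ∫ z, (∫ y, J₀ P X N s₀ Pi y z * u y ∂Pi.variation) * u z ∂Pi.variation := by
  have hu := U.measurable
  have huu : Measurable fun p : ℂ × ℂ => u p.1 * u p.2 := by fun_prop
  have hb : ∀ {F : ℂ × ℂ → ℂ}, Integrable F (Pi.variation.prod Pi.variation) →
      Integrable (fun p => F p * (u p.1 * u p.2)) (Pi.variation.prod Pi.variation) := fun hF =>
    hF.mul_bdd (c := 1) huu.aestronglyMeasurable (ae_of_all _ fun q => by simp [U.norm_eq_one])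
  have e1 : ∫ z, (∫ y, J₀ P X N s₀ Pi y z * u y ∂Pi.variation) * u z ∂Pi.variation =
      ∫ p, J₀ P X N s₀ Pi p.1 p.2 * (u p.1 * u p.2) ∂Pi.variation.prod Pi.variation := by
    -- The symmetric form of Fubini, since the inner integral runs over the first variable y.
    rw [integral_prod_symm _ (hb (M.integrable_J₀ hs₀ hsupp))]
    simp only [← integral_mul_const, mul_assoc]
  have e2 : ∫ p, J₀ P X N s₀ Pi p.1 p.2 * (u p.1 * u p.2) ∂Pi.variation.prod Pi.variation =
      ∫ p, ∑ k ∈ Finset.Icc 1 N,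
      ((∏ j ∈ Finset.Icc (k + 1) N, riskFactor P X (j - 1) : ℝ) : ℂ) *
        ((∫ ω, residKernel P X N (Real.log s₀) (k - 1) p.1 ω *
          residKernel P X N (Real.log s₀) (k - 1) p.2 ω ∂P) * (u p.1 * u p.2))
          ∂Pi.variation.prod Pi.variation := by
    refine integral_congr_ae ?_
    filter_upwards [M.J₀_ae_eq hs₀ hsupp] with p hp
    rw [hp, Finset.sum_mul]
    simp only [mul_assoc]
  rw [e1, e2, integral_finsetSum _ fun k hk =>
    (hb (M.integrable_integral_residKernel_mul U.ae_mem _ hk)).const_mul _, minErr_eq_sum,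
    Complex.ofReal_sum]
  refine Finset.sum_congr rfl fun k hk => ?_
  rw [integral_const_mul, Complex.ofReal_mul, mul_comm,
    M.residSq_eq_integral U _ (by simp at hk; omega)]

end FinalError

/-! ### Identification of the objects in the statement -/

section Identification

variable {Ω : Type*} {mΩ : MeasurableSpace Ω} {P : Measure Ω}

theorem ofReal_exp_cpow (x : ℝ) (z : ℂ) : ((Real.exp x : ℝ) : ℂ) ^ z = Complex.exp (z * x) := by
  rw [Complex.cpow_def_of_ne_zero (by exact_mod_cast (Real.exp_pos x).ne'),
    ← Complex.ofReal_log (Real.exp_pos x).le, Real.log_exp, mul_comm]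

theorem integrable_exp_of_mem_expDomain {X : ℕ → Ω → ℝ} {N : ℕ} {t : ℝ}
    (ht : (t : ℂ) ∈ expDomain P X N) : Integrable (fun ω => Real.exp (t * X N ω)) P := by
  have h := Integrable.norm (show Integrable (fun ω => Complex.exp (t * (X N ω : ℂ))) P from ht)
  simpa only [Complex.norm_exp, ← Complex.ofReal_mul, Complex.ofReal_re] using h

/-- By compactness the extreme real parts are attained on K, so the moment hypothesis applies to
them directly. -/
theorem exists_strip {X : ℕ → Ω → ℝ} {N : ℕ} {K : Set ℂ} (hX : Measurable (X N))
    (h_two : (2 : ℂ) ∈ expDomain P X N) (hK : IsCompact (Complex.re '' K))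
    (hdom : ∀ x ∈ Complex.re '' K, ((2 * x : ℝ) : ℂ) ∈ expDomain P X N) :
    ∃ α β : ℝ, K ⊆ strip α β ∧ ExpMoments P (X N) α β := by
  have h2 : Integrable (fun ω => Real.exp (2 * X N ω)) P :=
    integrable_exp_of_mem_expDomain (by simpa using h_two)
  rcases K.eq_empty_or_nonempty with rfl | hne
  -- Empty support: any strip will do, and α = β = 1 needs only the second exponential moment.
  · exact ⟨1, 1, Set.empty_subset _, hX, by simpa using h2, by simpa using h2, h2⟩
  · obtain ⟨α, hα⟩ := hK.exists_isLeast (hne.image _)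
    obtain ⟨β, hβ⟩ := hK.exists_isGreatest (hne.image _)
    exact ⟨α, β, fun z hz => ⟨hα.2 ⟨z, hz, rfl⟩, hβ.2 ⟨z, hz, rfl⟩⟩, hX,
      integrable_exp_of_mem_expDomain (hdom α hα.1), integrable_exp_of_mem_expDomain (hdom β hβ.1),
      h2⟩

variable {X : ℕ → Ω → ℝ} {N : ℕ} {s₀ : ℝ} {Pi : ComplexMeasure ℂ} {u : ℂ → ℂ}

theorem cint_cpow_eq_lap (hu : ∀ F : ℂ → ℂ, cint Pi F = ∫ z, F z * u z ∂Pi.variation) (c : ℂ → ℂ)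
    (x : ℝ) : cint Pi (fun z => c z * ((Real.exp x : ℝ) : ℂ) ^ z) =
      lap Pi.variation (fun z => c z * u z) x := by
  rw [hu, lap]
  refine integral_congr_ae (ae_of_all _ fun z => ?_)
  simp only [ofReal_exp_cpow]
  ring

theorem claim_eq_eta (hs₀ : 0 < s₀)
    (hu : ∀ F : ℂ → ℂ, cint Pi F = ∫ z, F z * u z ∂Pi.variation) (n : ℕ) (ω : Ω) :
    claim P X N s₀ Pi n ω = eta P X N Pi.variation u n (Real.log s₀ + X n ω) := by
  rw [claim, price_eq_exp hs₀, cint_cpow_eq_lap hu]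
  rfl

theorem xi_eq_chi (hs₀ : 0 < s₀)
    (hu : ∀ F : ℂ → ℂ, cint Pi F = ∫ z, F z * u z ∂Pi.variation) (n : ℕ) (ω : Ω) :
    xi P X N s₀ Pi (n + 1) ω =
      chi P X N Pi.variation u (n + 1) (Real.log s₀ + X n ω) / (price s₀ X n ω : ℂ) := by
  have h0 : (price s₀ X n ω : ℂ) ≠ 0 := by exact_mod_cast (price_pos hs₀ X n ω).ne'
  rw [xi, hu, chi, lap, ← integral_div]
  refine integral_congr_ae (ae_of_all _ fun z => ?_)
  simp only [Nat.add_sub_cancel]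
  rw [Complex.cpow_sub _ _ h0, Complex.cpow_one, price_eq_exp hs₀, ofReal_exp_cpow]
  ring

theorem Market.lam_eq [IsProbabilityMeasure P] {ℱ : Filtration ℕ mΩ} {α β : ℝ}
    (M : Market P N ℱ X α β) {n : ℕ} (hn : n < N) (ω : Ω) :
    lam P X s₀ (n + 1) ω =
      (((∫ ω, ret X n ω ∂P) / (∫ ω, ret X n ω ^ 2 ∂P) : ℝ) : ℂ) / (price s₀ X n ω : ℂ) := by
  rw [lam, Market.m_one, Market.m_two, M.integral_ret hn, M.integral_ret_sq hn, Nat.add_sub_cancel]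
  push_cast
  ring

theorem RealSpectrum.of_payoff {α β : ℝ} (hsupp : supp Pi ⊆ strip α β) (hum : Measurable u)
    (hu1 : ∀ z, ‖u z‖ = 1) (hu : ∀ F : ℂ → ℂ, cint Pi F = ∫ z, F z * u z ∂Pi.variation)
    {f : ℝ → ℝ} (hf : ∀ s : ℝ, 0 < s → (f s : ℂ) = cint Pi fun z => (s : ℂ) ^ z) :
    RealSpectrum Pi.variation u α β ∧
      ∀ x, (f (Real.exp x) : ℂ) = lap Pi.variation u x := by
  have h : ∀ x, (f (Real.exp x) : ℂ) = lap Pi.variation u x := fun x => by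
    rw [hf _ (Real.exp_pos x)]
    simpa using cint_cpow_eq_lap hu (fun _ => 1) x
  exact ⟨⟨(supp_mem_ae Pi).mono fun z hz => hsupp hz, hum, hu1,
    fun x => by rw [← h, Complex.ofReal_im]⟩, h⟩

theorem hedgingError_eq_gap (hs₀ : 0 < s₀) {f : ℝ → ℝ}
    (hf : ∀ x, (f (Real.exp x) : ℂ) = lap Pi.variation u x) (V : ℝ) (v : ℕ → Ω → ℝ) :
    hedgingError P (price s₀ X) N (fun ω => f (price s₀ X N ω)) V v =
      ∫ ω, gap P X N Pi.variation u s₀ V v N ω ^ 2 ∂P := by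
  have h : ∀ ω, f (price s₀ X N ω) = etaR P X N Pi.variation u N (Real.log s₀ + X N ω) := fun ω => by
    rw [price_eq_exp hs₀, etaR, Market.eta_terminal, ← hf, Complex.ofReal_re]
  simp only [hedgingError, gap, h]

end Identification

end DiscreteHedging

theorem mainTheorem2 {Ω : Type*} {mΩ : MeasurableSpace Ω} (P : Measure Ω) [IsProbabilityMeasure P]
    (N : ℕ) (hN : 1 ≤ N) (ℱ : Filtration ℕ mΩ) (X : ℕ → Ω → ℝ)
    (hX_zero : ∀ ω, X 0 ω = 0)
    (hX_adapted : ∀ n ≤ N, Measurable[ℱ n] (X n))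
    (hX_indep : ∀ n ∈ Finset.Icc 1 N,
      Indep (MeasurableSpace.comap (DiscreteHedging.incr X n) inferInstance) (ℱ (n - 1)) P)
    (s₀ : ℝ) (hs₀ : 0 < s₀)
    (hX_nondet : ∀ n ∈ Finset.Icc 1 N,
      ¬ ∃ c : ℝ, ∀ᵐ ω ∂P, DiscreteHedging.incr X n ω = c)
    (h_two : (2 : ℂ) ∈ DiscreteHedging.expDomain P X N)
    (Pi : ComplexMeasure ℂ)
    (hPi_compact : IsCompact (Complex.re '' DiscreteHedging.supp Pi))
    (hPi_dom : ∀ x ∈ Complex.re '' DiscreteHedging.supp Pi,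
      ((2 * x : ℝ) : ℂ) ∈ DiscreteHedging.expDomain P X N)
    (f : ℝ → ℝ)
    (hf : ∀ s : ℝ, 0 < s → (f s : ℂ) = DiscreteHedging.cint Pi fun z => (s : ℂ) ^ z) :
    let S : ℕ → Ω → ℝ := DiscreteHedging.price s₀ X
    let H : Ω → ℝ := fun ω => f (S N ω)
    let Θ : Set (ℕ → Ω → ℝ) := DiscreteHedging.Theta P ℱ S N
    ∃ V₀ : ℝ, ∃ φ ∈ Θ,
      (∀ ω, (V₀ : ℂ) = DiscreteHedging.claim P X N s₀ Pi 0 ω) ∧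
      (∀ n ∈ Finset.Icc 1 N, ∀ᵐ ω ∂P,
        (φ n ω : ℂ) = DiscreteHedging.xi P X N s₀ Pi n ω + DiscreteHedging.lam P X s₀ n ω *
          (DiscreteHedging.claim P X N s₀ Pi (n - 1) ω - DiscreteHedging.claim P X N s₀ Pi 0 ω -
            (DiscreteHedging.gain S φ (n - 1) ω : ℂ))) ∧
      IsLeast {e : ℝ | ∃ V : ℝ, ∃ v ∈ Θ, e = DiscreteHedging.hedgingError P S N H V v}
        (DiscreteHedging.hedgingError P S N H V₀ φ) ∧
      Integrable (fun p : ℂ × ℂ => DiscreteHedging.J₀ P X N s₀ Pi p.1 p.2)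
        (Pi.variation.prod Pi.variation) ∧
      (DiscreteHedging.hedgingError P S N H V₀ φ : ℂ) =
        DiscreteHedging.cint Pi fun z => DiscreteHedging.cint Pi fun y =>
          DiscreteHedging.J₀ P X N s₀ Pi y z := by
  intro S H Θ
  obtain ⟨α, β, hsupp, hmom⟩ := DiscreteHedging.exists_strip
    ((hX_adapted N le_rfl).mono (ℱ.le _) le_rfl) h_two hPi_compact hPi_dom
  have M : DiscreteHedging.Market P N ℱ X α β := ⟨hX_zero, hX_adapted, hX_indep, hX_nondet, hmom⟩
  have hfin := DiscreteHedging.isFiniteMeasure_variation Pi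
  obtain ⟨u, hum, hu1, hu⟩ := DiscreteHedging.exists_cint_eq_integral Pi
  obtain ⟨U, hf'⟩ := DiscreteHedging.RealSpectrum.of_payoff hsupp hum hu1 hu hf
  have hΘ := M.optimalStrategy_mem U hs₀ le_rfl
  have hV : ∀ ω, DiscreteHedging.claim P X N s₀ Pi 0 ω =
      DiscreteHedging.etaR P X N Pi.variation u 0 (Real.log s₀) := fun ω => by
    rw [DiscreteHedging.claim_eq_eta hs₀ hu, hX_zero, add_zero, M.eta_re U (Nat.zero_le N)]
  have hmin : DiscreteHedging.hedgingError P S N H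
      (DiscreteHedging.etaR P X N Pi.variation u 0 (Real.log s₀))
      (DiscreteHedging.optimalStrategy P X N Pi.variation u s₀) =
        DiscreteHedging.minErr P X N Pi.variation u (Real.log s₀) N :=
    (DiscreteHedging.hedgingError_eq_gap hs₀ hf' _ _).trans
      (M.integral_gap_sq_eq_minErr U le_rfl hΘ rfl fun k _ ω =>
        DiscreteHedging.Market.optimalStrategy_mul_price hs₀ k ω)
  refine ⟨DiscreteHedging.etaR P X N Pi.variation u 0 (Real.log s₀),
    DiscreteHedging.optimalStrategy P X N Pi.variation u s₀, hΘ, fun ω => (hV ω).symm, ?_,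
    ⟨⟨_, _, hΘ, rfl⟩, ?_⟩, M.integrable_J₀ hs₀ hsupp, ?_⟩
  · intro n hn
    obtain ⟨k, rfl⟩ : ∃ k, n = k + 1 := ⟨n - 1, by simp at hn; omega⟩
    have hk : k < N := by simp at hn; omega
    -- The feedback strategy satisfies the recursion at every ω, not only almost surely.
    refine Filter.Eventually.of_forall fun ω => ?_
    have h0 : (DiscreteHedging.price s₀ X k ω : ℂ) ≠ 0 := by
      exact_mod_cast (DiscreteHedging.price_pos hs₀ X k ω).ne'
    have h1 := congrArg (fun x : ℝ => (x : ℂ))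
      (DiscreteHedging.Market.optimalStrategy_mul_price (P := P) (X := X) (N := N)
        (μ := Pi.variation) (u := u) hs₀ k ω)
    simp only [DiscreteHedging.gap, Complex.ofReal_mul, Complex.ofReal_add,
      Complex.ofReal_sub] at h1
    rw [M.eta_re U hk.le, M.chi_re U hk] at h1
    rw [hV, DiscreteHedging.xi_eq_chi hs₀ hu, M.lam_eq hk, Nat.add_sub_cancel,
      DiscreteHedging.claim_eq_eta hs₀ hu, eq_div_of_mul_eq h0 h1]
    ring
  · rintro e ⟨V, v, hv, rfl⟩
    rw [hmin]
    exact (M.minErr_le U le_rfl hv V).trans_eq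
      (DiscreteHedging.hedgingError_eq_gap hs₀ hf' V v).symm
  · rw [hmin, M.minErr_eq_integral hs₀ hsupp U, hu]
    simp only [hu]
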